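/- Let $I\subseteq\mathbb R$ be an open interval and let $X:I\to\mathbb R^2$ be a strictly locally convex plane curve, that is: $X$ is of class $C^3$ and regular; every $s\in I$ has an open subinterval $I_0\subseteq I$ around it such that for each $u\in I_0$ the arc $X(I_0)$ lies on one side of the tangent line at $X(u)$; and, with $N$ the unit normal pointing to the convex side (the side of the tangent line on which the curve lies locally), the curvature of $X$ with respect to $N$ is positive everywhere. For a point $P=X(s)$ of the curve and sufficiently small $h>0$, let $t$ be the tangent line of $X$ at $P$, let $\ell$ be the line through $P+hN(P)$ parallel to $t$, and let $A$ and $B$ be the points at which the curve, followed from $P$ in either direction, first meets $\ell$. Let $t_1,t_2$ be the tangent lines of $X$ at $A,B$, put $Q=t_1\cap t_2$, $A_1=t_1\cap t$, $B_1=t_2\cap t$, and let $k_P(h)$ be the distance from the centroid of the triangle $QA_1B_1$ to the line $\ell$. Then the following are equivalent. 1. There are real-valued functions $\lambda$ and $\mu$ on the curve such that for every $P$ one has $k_P(h)=\lambda(P)h^{\mu(P)}$ for all sufficiently small $h>0$. 2. For every $P$ one has $k_P(h)=\frac43 h$ for all sufficiently small $h>0$. 3. $X$ is an open part of a parabola,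 that is, $X(I)$ is a relatively open subset of some parabola. Here a point of the curve is understood together with its parameter (which matters only if $X$ intersects itself), and how small $h$ has to be may depend on $P$. -/

import Mathlib

open Set Filter Topology

noncomputable section

namespace CentroidParabola

/-- The Euclidean plane. -/
abbrev Plane : Type := EuclideanSpace ℝ (Fin 2)

/-- The line through `p` with direction vector `v` (used only for `v ≠ 0`). -/
def lineThrough (p v : Plane) : AffineSubspace ℝ Plane :=
  AffineSubspace.mk' p (Submodule.span ℝ {v})

/-- The tangent line of `X` at the parameter `s`. -/
def tangentLine (X : ℝ → Plane) (s : ℝ) : AffineSubspace ℝ Plane :=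
  lineThrough (X s) (deriv X s)

/-- `X` restricted to `J` is a convex curve: for every `s ∈ J` the trace `X(J)` lies in one of the
two closed half-planes bounded by the tangent line at `X s`. -/
def IsConvexCurveOn (X : ℝ → Plane) (J : Set ℝ) : Prop :=
  ∀ s ∈ J, ∃ n : Plane, n ≠ 0 ∧ inner ℝ (deriv X s) n = 0 ∧ ∀ u ∈ J, 0 ≤ inner ℝ (X u - X s) n

/-- `X` is locally convex on `I`: every parameter has an open subinterval around it on which the
curve is convex. -/
def IsLocallyConvexCurveOn (X : ℝ → Plane) (I : Set ℝ) : Prop :=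
  ∀ s ∈ I, ∃ a b : ℝ, s ∈ Ioo a b ∧ Ioo a b ⊆ I ∧ IsConvexCurveOn X (Ioo a b)

/-- `n` is the unit normal of `X` at `s` pointing to the convex side, that is, to the side of the
tangent line on which the curve lies near `s`. -/
structure IsConvexSideNormal (X : ℝ → Plane) (s : ℝ) (n : Plane) : Prop where
  norm_eq_one : ‖n‖ = 1
  inner_eq_zero : inner ℝ (deriv X s) n = 0
  convex_side : ∀ᶠ u in 𝓝 s, 0 ≤ inner ℝ (X u - X s) n

/-- The curvature of the regular curve `X` at `s` with respect to the unit normal `n`, for an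
arbitrary regular parametrization (for arc length it is `⟪X'' s, n⟫`). -/
def curvature (X : ℝ → Plane) (s : ℝ) (n : Plane) : ℝ :=
  inner ℝ (deriv (deriv X) s) n / ‖deriv X s‖ ^ 2

/-- `X` is a strictly locally convex curve on the open interval `I`, and `N` is its unit normal
pointing to the convex side. -/
structure IsStrictlyLocallyConvex (X : ℝ → Plane) (I : Set ℝ) (N : ℝ → Plane) : Prop where
  contDiffOn : ContDiffOn ℝ 3 X I
  regular : ∀ s ∈ I, deriv X s ≠ 0
  locallyConvex : IsLocallyConvexCurveOn X I
  normal : ∀ s ∈ I, IsConvexSideNormal X s (N s)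
  curvature_pos : ∀ s ∈ I, 0 < curvature X s (N s)

/-- The line `ℓ` through `P + h N(P)`, where `P = X s`, parallel to the tangent line at `P`. -/
def chordLine (X N : ℝ → Plane) (s h : ℝ) : AffineSubspace ℝ Plane :=
  lineThrough (X s + h • N s) (deriv X s)

/-- `A = X α` and `B = X β` are the end points of the chord that `ℓ` cuts off around `P = X s`:
the first points on either side of `P` at which the curve meets `ℓ`. -/
structure IsChord (X : ℝ → Plane) (I : Set ℝ) (N : ℝ → Plane) (s h α β : ℝ) : Prop where
  left_lt : α < s
  lt_right : s < β
  subset : Icc α β ⊆ I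
  left_mem : X α ∈ chordLine X N s h
  right_mem : X β ∈ chordLine X N s h
  notMem : ∀ u ∈ Ioo α β, X u ∉ chordLine X N s h

/-- `k_P(h) = k` for `P = X s`: with `t`, `t₁`, `t₂` the tangent lines at `P`, `A`, `B`, the lines
`t₁, t₂` meet in exactly one point `Q`, `t₁, t` in exactly one point `A₁`, `t₂, t` in exactly one
point `B₁`, and `k` is the distance from the centroid of the triangle `Q A₁ B₁` to `ℓ`.
At most one `k` has this property. -/
def IsCentroidDist (X : ℝ → Plane) (I : Set ℝ) (N : ℝ → Plane) (s h k : ℝ) : Prop :=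
  ∃ (α β : ℝ) (Q A₁ B₁ : Plane),
    IsChord X I N s h α β ∧
    (tangentLine X α : Set Plane) ∩ tangentLine X β = {Q} ∧
    (tangentLine X α : Set Plane) ∩ tangentLine X s = {A₁} ∧
    (tangentLine X β : Set Plane) ∩ tangentLine X s = {B₁} ∧
    k = Metric.infDist (Finset.univ.centroid ℝ ![Q, A₁, B₁]) (chordLine X N s h)

/-- A parabola: the points equidistant from a focus and a directrix not through the focus. -/
def IsParabola (S : Set Plane) : Prop :=
  ∃ F p v : Plane, v ≠ 0 ∧ F ∉ lineThrough p v ∧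
    S = {x | dist x F = Metric.infDist x (lineThrough p v)}

/-- The trace of `X` is an open part of a parabola, that is, a relatively open subset of one
(for an interval `I` the trace is connected). -/
def IsOpenPartOfParabola (X : ℝ → Plane) (I : Set ℝ) : Prop :=
  ∃ S U : Set Plane, IsParabola S ∧ IsOpen U ∧ X '' I = S ∩ U

end CentroidParabola

end

/-!
In the affine frame of velocity and acceleration at a point `P`, let `L(y)` be the length of the
chord parallel to the tangent line at height `y`. The tangent lines at its end points meet at height
`y - L / L'` and meet the tangent line at `P` at height `0`, so that `h` and `k_P(h)` are the same
multiple of `y` and of `2 y / 3 + L / (3 L')`. Since `L / L' ~ 2 y`, a power law can only be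
`k_P(h) = 4 h / 3`, and this means `L = 2 y L'`, that is, `L ^ 2 = 8 y`.

Where `L ^ 2 = 8 y` holds for heights up to a bound that is uniform in the base point, it can be
differentiated along the curve at constant height. An integration in `y` then shows that the
midpoints of the chords lie on a line, so that together with `L ^ 2 = 8 y` an arc of a parabola
results. By Baire's theorem such a uniform bound exists near some point. At an end point of an arc
of the parabola, the arc on one side and the chord lengths determine the curve on the other side, so
the curve never leaves the parabola.
-/

noncomputable section

namespace CentroidParabola

/-! ### The Euclidean plane -/

section Plane

variable {v w : Plane}

/-- The standard area form of the plane, bundled as a continuous bilinear form so that it can be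
differentiated. -/
def wedge : Plane →L[ℝ] Plane →L[ℝ] ℝ :=
  (EuclideanSpace.proj 0).smulRight (EuclideanSpace.proj 1) -
    (EuclideanSpace.proj 1).smulRight (EuclideanSpace.proj 0)

theorem wedge_apply (v w : Plane) : wedge v w = v 0 * w 1 - v 1 * w 0 := by
  simp [wedge]

theorem inner_apply (v w : Plane) : inner ℝ v w = v 0 * w 0 + v 1 * w 1 := by
  simp [PiLp.inner_apply, Fin.sum_univ_two, mul_comm]

theorem wedge_self (v : Plane) : wedge v v = 0 := by
  simp only [wedge_apply]; ring

theorem wedge_swap (v w : Plane) : wedge w v = -wedge v w := by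
  simp only [wedge_apply]; ring

theorem left_ne_zero_of_wedge_ne_zero (h : wedge v w ≠ 0) : v ≠ 0 := by
  rintro rfl
  simp at h

theorem right_ne_zero_of_wedge_ne_zero (h : wedge v w ≠ 0) : w ≠ 0 := by
  rintro rfl
  simp at h

theorem wedge_smul_eq (v w u : Plane) : wedge v w • u = wedge u w • v + wedge v u • w := by
  ext i
  fin_cases i <;> simp [wedge_apply] <;> ring

theorem inner_mul_inner_sub (c d v w : Plane) :
    inner ℝ c v * inner ℝ d w - inner ℝ c w * inner ℝ d v = wedge c d * wedge v w := by
  simp only [inner_apply, wedge_apply]; ring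

theorem norm_sq_mul_inner (v c w : Plane) :
    ‖v‖ ^ 2 * inner ℝ c w = inner ℝ v c * inner ℝ v w + wedge v c * wedge v w := by
  simp only [← real_inner_self_eq_norm_sq, inner_apply, wedge_apply]; ring

theorem inner_sq_add_wedge_sq (v w : Plane) :
    inner ℝ v w ^ 2 + wedge v w ^ 2 = (‖v‖ * ‖w‖) ^ 2 := by
  simp only [mul_pow, ← real_inner_self_eq_norm_sq, inner_apply, wedge_apply]; ring

theorem abs_wedge_eq_of_inner_eq_zero (h : inner ℝ v w = 0) : |wedge v w| = ‖v‖ * ‖w‖ := by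
  rw [← abs_of_nonneg (by positivity : 0 ≤ ‖v‖ * ‖w‖), ← sq_eq_sq_iff_abs_eq_abs,
    ← inner_sq_add_wedge_sq, h]
  ring

theorem abs_wedge_le_norm_mul_norm (v w : Plane) : |wedge v w| ≤ ‖v‖ * ‖w‖ := by
  refine abs_le_of_sq_le_sq ?_ (by positivity)
  nlinarith [inner_sq_add_wedge_sq v w, sq_nonneg (inner ℝ v w)]

theorem eq_zero_of_inner_eq_zero {c d : Plane} (h : wedge c d ≠ 0) (hc : inner ℝ c v = 0)
    (hd : inner ℝ d v = 0) : v = 0 := by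
  rw [wedge_apply] at h
  rw [inner_apply] at hc hd
  ext i
  refine mul_left_cancel₀ h ?_
  fin_cases i
  · simp only [Fin.zero_eta, PiLp.zero_apply]
    linear_combination d 1 * hc - c 1 * hd
  · simp only [Fin.mk_one, PiLp.zero_apply]
    linear_combination c 0 * hd - d 0 * hc

theorem exists_inner_eq_wedge_eq (hv : v ≠ 0) (a b : ℝ) :
    ∃ x : Plane, inner ℝ v x = a ∧ wedge v x = b := by
  have hn : v 0 ^ 2 + v 1 ^ 2 ≠ 0 := by
    rw [← Fin.sum_univ_two (fun i => v i ^ 2), ← EuclideanSpace.real_norm_sq_eq]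
    positivity
  refine ⟨!₂[(a * v 0 - b * v 1) / (v 0 ^ 2 + v 1 ^ 2),
    (a * v 1 + b * v 0) / (v 0 ^ 2 + v 1 ^ 2)], ?_, ?_⟩ <;>
  · simp only [inner_apply, wedge_apply, Matrix.cons_val_zero, Matrix.cons_val_one]
    field_simp
    ring

end Plane

section Lines

variable {p q v w x : Plane}

theorem mem_lineThrough_iff_exists : x ∈ lineThrough p v ↔ ∃ r : ℝ, p + r • v = x := by
  simp only [lineThrough, AffineSubspace.mem_mk', Submodule.mem_span_singleton, vsub_eq_sub,
    eq_sub_iff_add_eq']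

theorem infDist_lineThrough (hv : v ≠ 0) (p x : Plane) :
    Metric.infDist x (lineThrough p v) = |wedge v (x - p)| / ‖v‖ := by
  have hn : 0 < ‖v‖ := norm_pos_iff.2 hv
  have wedge_sub (r : ℝ) : wedge v (x - (p + r • v)) = wedge v (x - p) := by
    simp [map_sub, wedge_self]
  refine le_antisymm ?_ ((Metric.le_infDist ⟨p, mem_lineThrough_iff_exists.2 ⟨0, by simp⟩⟩).2 ?_)
  · set foot := p + (inner ℝ v (x - p) / ‖v‖ ^ 2) • v with hfoot
    have hperp : inner ℝ v (x - foot) = 0 := by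
      rw [hfoot, ← sub_sub, inner_sub_right, inner_smul_right, real_inner_self_eq_norm_sq]
      field_simp
      ring
    have hmem : foot ∈ (lineThrough p v : Set Plane) := mem_lineThrough_iff_exists.2 ⟨_, rfl⟩
    refine (Metric.infDist_le_dist_of_mem hmem).trans_eq ?_
    rw [← wedge_sub (inner ℝ v (x - p) / ‖v‖ ^ 2), abs_wedge_eq_of_inner_eq_zero hperp,
      dist_eq_norm]
    field_simp
  · intro z hz
    obtain ⟨r, rfl⟩ := mem_lineThrough_iff_exists.1 hz
    rw [← wedge_sub r, div_le_iff₀' hn, dist_eq_norm]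
    exact abs_wedge_le_norm_mul_norm _ _

theorem mem_lineThrough_iff (hv : v ≠ 0) : x ∈ lineThrough p v ↔ wedge v (x - p) = 0 := by
  have hclosed : IsClosed (lineThrough p v : Set Plane) :=
    AffineSubspace.closed_of_finiteDimensional _
  have hne : (lineThrough p v : Set Plane).Nonempty :=
    ⟨p, mem_lineThrough_iff_exists.2 ⟨0, by simp⟩⟩
  rw [← SetLike.mem_coe, hclosed.mem_iff_infDist_zero hne, infDist_lineThrough hv,
    div_eq_zero_iff, abs_eq_zero, norm_eq_zero, or_iff_left hv]

theorem inter_lineThrough_eq_singleton (h : wedge v w ≠ 0) :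
    (lineThrough p v : Set Plane) ∩ lineThrough q w =
      {p + (wedge (q - p) w / wedge v w) • v} := by
  have hmem (r : ℝ) : p + r • v ∈ lineThrough q w ↔ r = wedge (q - p) w / wedge v w := by
    have hsub : p + r • v - q = r • v - (q - p) := by abel
    rw [mem_lineThrough_iff (right_ne_zero_of_wedge_ne_zero h), eq_div_iff h, wedge_swap _ w,
      neg_eq_zero, hsub, map_sub, map_smul, sub_apply, smul_apply, smul_eq_mul, sub_eq_zero]
  ext x
  simp only [mem_inter_iff, SetLike.mem_coe, mem_singleton_iff]
  constructor
  · rintro ⟨hxv, hxw⟩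
    obtain ⟨r, rfl⟩ := mem_lineThrough_iff_exists.1 hxv
    rw [← (hmem r).1 hxw]
  · rintro rfl
    exact ⟨mem_lineThrough_iff_exists.2 ⟨_, rfl⟩, (hmem _).2 rfl⟩

theorem centroid_triangle (P Q R : Plane) :
    Finset.univ.centroid ℝ ![P, Q, R] = (1 / 3 : ℝ) • (P + Q + R) := by
  rw [Finset.centroid_def, Finset.affineCombination_eq_linear_combination]
  · simp [Fin.sum_univ_three, Finset.centroidWeights_apply]
  · exact Finset.sum_centroidWeights_eq_one_of_nonempty ℝ _ Finset.univ_nonempty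

end Lines

section Parabolas

theorem dist_eq_infDist_lineThrough_iff {F p v : Plane} (hv : v ≠ 0) (x : Plane) :
    dist x F = Metric.infDist x (lineThrough p v) ↔
      inner ℝ v (x - F) ^ 2 = 2 * wedge v (F - p) * wedge v (x - F) + wedge v (F - p) ^ 2 := by
  have hn : 0 < ‖v‖ := norm_pos_iff.2 hv
  have hsplit : wedge v (x - p) = wedge v (x - F) + wedge v (F - p) := by
    rw [← map_add, sub_add_sub_cancel]
  rw [infDist_lineThrough hv, eq_div_iff hn.ne', dist_eq_norm, mul_comm,
    ← abs_of_nonneg (by positivity : 0 ≤ ‖v‖ * ‖x - F‖), ← sq_eq_sq_iff_abs_eq_abs,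
    ← inner_sq_add_wedge_sq, hsplit]
  constructor <;> intro h <;> linear_combination h

theorem isParabola_of_orthogonal {v : Plane} (hv : v ≠ 0) {g : ℝ} (hg : g ≠ 0) (a b : ℝ) :
    IsParabola {x | (inner ℝ v x + a) ^ 2 = 2 * g * wedge v x + b} := by
  obtain ⟨F, hF₁, hF₂⟩ := exists_inner_eq_wedge_eq hv (-a) ((g ^ 2 - b) / (2 * g))
  obtain ⟨p, -, hp⟩ := exists_inner_eq_wedge_eq hv 0 (wedge v F - g)
  have hgp : wedge v (F - p) = g := by rw [map_sub, hp]; ring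
  refine ⟨F, p, v, hv, by rwa [mem_lineThrough_iff hv, hgp], ?_⟩
  ext x
  rw [mem_ofPred_eq, mem_ofPred_eq, dist_eq_infDist_lineThrough_iff hv, hgp, inner_sub_right,
    map_sub, hF₁, hF₂]
  field_simp
  constructor <;> intro h <;> linear_combination h

theorem isParabola_of_wedge_ne_zero {c d : Plane} (h : wedge c d ≠ 0) (a b : ℝ) :
    IsParabola {x | (inner ℝ c x + a) ^ 2 = inner ℝ d x + b} := by
  have hc := left_ne_zero_of_wedge_ne_zero h
  have hn : 0 < ‖c‖ ^ 2 := by positivity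
  set t : ℝ := -(inner ℝ c d / (2 * ‖c‖ ^ 2)) with ht
  set g : ℝ := wedge c d / (2 * ‖c‖ ^ 2) with hg
  have hd (x : Plane) : inner ℝ d x = 2 * g * wedge c x - 2 * t * inner ℝ c x := by
    rw [← mul_left_cancel_iff_of_pos hn, norm_sq_mul_inner, ht, hg]
    field_simp
    ring
  -- Adding `t` to the square makes the linear part of the right-hand side orthogonal to `c`.
  convert isParabola_of_orthogonal hc (by positivity : g ≠ 0) (a + t) (b + 2 * t * a + t ^ 2)
    using 1
  ext x
  rw [mem_ofPred_eq, mem_ofPred_eq, hd]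
  constructor <;> intro h <;> linear_combination h

theorem isParabola_iff (S : Set Plane) :
    IsParabola S ↔ ∃ (c d : Plane) (a b : ℝ), wedge c d ≠ 0 ∧
      S = {x | (inner ℝ c x + a) ^ 2 = inner ℝ d x + b} := by
  refine ⟨?_, fun ⟨c, d, a, b, h, hS⟩ => hS ▸ isParabola_of_wedge_ne_zero h a b⟩
  rintro ⟨F, p, v, hv, hF, rfl⟩
  rw [mem_lineThrough_iff hv] at hF
  set g := wedge v (F - p) with hg
  obtain ⟨d, hd₁, hd₂⟩ := exists_inner_eq_wedge_eq hv 0 (2 * g * ‖v‖ ^ 2)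
  have hwedge (x : Plane) : inner ℝ d x = 2 * g * wedge v x := by
    rw [← mul_left_cancel_iff_of_pos (by positivity : 0 < ‖v‖ ^ 2), norm_sq_mul_inner, hd₁, hd₂]
    ring
  refine ⟨v, d, -inner ℝ v F, g ^ 2 - 2 * g * wedge v F, ?_, ?_⟩
  · rw [hd₂]; positivity
  · ext x
    rw [mem_ofPred_eq, mem_ofPred_eq, dist_eq_infDist_lineThrough_iff hv, hwedge, ← hg,
      inner_sub_right, map_sub]
    constructor <;> intro h <;> linear_combination h

end Parabolas

/-! ### Inverse branches at a nondegenerate minimum -/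

section OneSided

variable {α β : Type*} [ConditionallyCompleteLinearOrder α] [DenselyOrdered α]
  [TopologicalSpace α] [OrderTopology α] [LinearOrder β] [TopologicalSpace β] [OrderTopology β]
  {f : α → β} {a b : α}

theorem map_nhdsGT_of_strictMonoOn (hab : a < b) (hcont : ContinuousOn f (Icc a b))
    (hf : StrictMonoOn f (Icc a b)) : map f (𝓝[>] a) = 𝓝[>] (f a) := by
  have ha : a ∈ Icc a b := left_mem_Icc.2 hab.le
  refine le_antisymm ?_ fun V hV => ?_
  · refine tendsto_nhdsWithin_iff.2 ⟨?_, ?_⟩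
    · exact (hcont a ha).mono_of_mem_nhdsWithin (Icc_mem_nhdsGT hab)
    · filter_upwards [Ioc_mem_nhdsGT hab] with u hu
      exact hf ha (Ioc_subset_Icc_self hu) hu.1
  · obtain ⟨c, ⟨hac, hcb⟩, hcV⟩ := (mem_nhdsGT_iff_exists_mem_Ioc_Ioo_subset hab).1 hV
    refine mem_of_superset (Ioo_mem_nhdsGT (hf ha ⟨hac.le, hcb⟩ hac)) ?_
    exact (intermediate_value_Ioo hac.le (hcont.mono (Icc_subset_Icc_right hcb))).trans
      (image_subset_iff.2 hcV)

theorem map_nhdsLT_of_strictAntiOn (hab : a < b) (hcont : ContinuousOn f (Icc a b))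
    (hf : StrictAntiOn f (Icc a b)) : map f (𝓝[<] b) = 𝓝[>] (f b) := by
  refine map_nhdsGT_of_strictMonoOn (α := αᵒᵈ) (a := OrderDual.toDual b) (b := OrderDual.toDual a)
    (f := f ∘ OrderDual.ofDual) hab ?_ ?_
  · rwa [Icc_toDual]
  · rw [Icc_toDual]
    exact fun x hx y hy hxy => hf hy hx hxy

end OneSided

theorem eventually_eq_of_hasDerivAt_zero {E : Type*} [NormedAddCommGroup E] [NormedSpace ℝ E]
    {f : ℝ → E} {a : ℝ} {c : E} (hf : ∀ᶠ y in 𝓝[>] a, HasDerivAt f 0 y)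
    (hc : Tendsto f (𝓝[>] a) (𝓝 c)) : ∀ᶠ y in 𝓝[>] a, f y = c := by
  obtain ⟨b, hab, hsub⟩ := mem_nhdsGT_iff_exists_Ioo_subset.1 hf
  have hconst : ∀ y ∈ Ioo a b, ∀ z ∈ Ioo a b, f z = f y := fun y hy z hz =>
    isOpen_Ioo.is_const_of_deriv_eq_zero isPreconnected_Ioo
      (fun w hw => (hsub hw).differentiableAt.differentiableWithinAt)
      (fun w hw => (hsub hw).deriv) hz hy
  filter_upwards [Ioo_mem_nhdsGT hab] with y hy
  refine tendsto_nhds_unique (tendsto_const_nhds.congr' ?_) hc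
  filter_upwards [Ioo_mem_nhdsGT hab] with z hz using (hconst y hy z hz).symm

theorem eventually_sq_eq_mul_iff {f : ℝ → ℝ} {c : ℝ}
    (hd : ∀ᶠ y in 𝓝[>] (0 : ℝ), DifferentiableAt ℝ f y) (hne : ∀ᶠ y in 𝓝[>] (0 : ℝ), f y ≠ 0)
    (hlim : Tendsto (fun y => f y ^ 2 / y) (𝓝[>] 0) (𝓝 c)) :
    (∀ᶠ y in 𝓝[>] (0 : ℝ), f y ^ 2 = c * y) ↔
      ∀ᶠ y in 𝓝[>] (0 : ℝ), f y = 2 * y * deriv f y := by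
  constructor
  · intro hsq
    filter_upwards [eventually_eventually_nhdsWithin.2 hsq, hd, hne, self_mem_nhdsWithin]
      with y hy hdy hney hy0
    rw [nhdsWithin_eq_nhds.2 (Ioi_mem_nhds hy0)] at hy
    have hderiv : (2 : ℕ) * f y ^ (2 - 1) * deriv f y = c * 1 :=
      (hdy.hasDerivAt.fun_pow 2).unique
        (((hasDerivAt_id' y).const_mul c).congr_of_eventuallyEq hy)
    have hval : f y ^ 2 = c * y := hy.self_of_nhds
    refine mul_left_cancel₀ hney ?_
    norm_num at hderiv
    linear_combination hval - y * hderiv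
  · intro hode
    have hconst : ∀ᶠ y in 𝓝[>] (0 : ℝ), HasDerivAt (fun y => f y ^ 2 / y) 0 y := by
      filter_upwards [hode, hd, self_mem_nhdsWithin] with y hy hdy hy0
      refine ((hdy.hasDerivAt.fun_pow 2).fun_div (hasDerivAt_id' y) (ne_of_gt hy0)).congr_deriv ?_
      rw [div_eq_zero_iff]
      left
      norm_num
      linear_combination -f y * hy
    filter_upwards [eventually_eq_of_hasDerivAt_zero hconst hlim, self_mem_nhdsWithin] with y hy hy0
    rwa [div_eq_iff (ne_of_gt hy0)] at hy

/-- `γ` is an inverse of `Y` defined on small positive heights, with values on one side of `s`: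
the side is given by the filter `l`, which is `𝓝[<] s` for `σ = -1` and `𝓝[>] s` for `σ = 1`. -/
structure IsBranch (Y γ : ℝ → ℝ) (s σ : ℝ) (l : Filter ℝ) : Prop where
  le_punctured : l ≤ 𝓝[≠] s
  sub_eq : ∀ᶠ u in l, u - s = σ * |u - s|
  map_eq : map Y l = 𝓝[>] 0
  left_inv : ∀ᶠ u in l, ∀ᶠ v in 𝓝 u, γ (Y v) = v

namespace IsBranch

variable {Y γ : ℝ → ℝ} {s σ : ℝ} {l : Filter ℝ}

theorem eventually_iff (B : IsBranch Y γ s σ l) {p : ℝ → Prop} :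
    (∀ᶠ y in 𝓝[>] 0, p y) ↔ ∀ᶠ u in l, p (Y u) := by
  rw [← B.map_eq, eventually_map]

theorem tendsto_iff (B : IsBranch Y γ s σ l) {f : ℝ → ℝ} {k : Filter ℝ} :
    Tendsto f (𝓝[>] 0) k ↔ Tendsto (fun u => f (Y u)) l k := by
  rw [← B.map_eq, tendsto_map'_iff, Function.comp_def]

theorem eventually_left_inv (B : IsBranch Y γ s σ l) : ∀ᶠ u in l, γ (Y u) = u :=
  B.left_inv.mono fun _ h => h.self_of_nhds

theorem eventually_right_inv (B : IsBranch Y γ s σ l) : ∀ᶠ y in 𝓝[>] 0, Y (γ y) = y :=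
  B.eventually_iff.2 (B.eventually_left_inv.mono fun _ h => congrArg Y h)

theorem tendsto (B : IsBranch Y γ s σ l) : Tendsto γ (𝓝[>] 0) l :=
  B.tendsto_iff.2 (tendsto_id.congr' (B.eventually_left_inv.mono fun _ h => h.symm))

theorem tendsto_nhds (B : IsBranch Y γ s σ l) : Tendsto γ (𝓝[>] 0) (𝓝 s) :=
  B.tendsto.mono_right (B.le_punctured.trans nhdsWithin_le_nhds)

theorem neBot (B : IsBranch Y γ s σ l) : l.NeBot := by
  rw [← map_neBot_iff Y, B.map_eq]
  infer_instance

theorem eventually_height_pos (B : IsBranch Y γ s σ l) : ∀ᶠ u in l, 0 < Y u :=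
  B.eventually_iff.1 self_mem_nhdsWithin

theorem sign_sq_eq_one (B : IsBranch Y γ s σ l) : σ ^ 2 = 1 := by
  have := B.neBot
  obtain ⟨u, hu, hne⟩ := (B.sub_eq.and (B.le_punctured self_mem_nhdsWithin)).exists
  have hpos : (u - s) ^ 2 ≠ 0 := pow_ne_zero _ (sub_ne_zero.2 hne)
  refine mul_right_cancel₀ hpos ?_
  rw [one_mul, ← sq_abs (u - s), ← mul_pow, ← hu, sq_abs]

end IsBranch

/-- `α` and `β` are the left and the right inverse branch of `Y` at `s`, so that `α y` and `β y`
are the parameters of the end points of the chord at height `y`. -/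
structure ChordBranches (Y α β : ℝ → ℝ) (s : ℝ) : Prop where
  left : IsBranch Y α s (-1) (𝓝[<] s)
  right : IsBranch Y β s 1 (𝓝[>] s)
  eventually_lt : ∀ᶠ y in 𝓝[>] (0 : ℝ), ∀ u ∈ Ioo (α y) (β y), Y u < y

namespace ChordBranches

variable {Y α β : ℝ → ℝ} {s : ℝ}

theorem eventually_left_lt (B : ChordBranches Y α β s) : ∀ᶠ y in 𝓝[>] (0 : ℝ), α y < s :=
  B.left.tendsto.eventually self_mem_nhdsWithin

theorem eventually_lt_right (B : ChordBranches Y α β s) : ∀ᶠ y in 𝓝[>] (0 : ℝ), s < β y :=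
  B.right.tendsto.eventually self_mem_nhdsWithin

theorem eventually_Icc_subset (B : ChordBranches Y α β s) {U : Set ℝ} (hU : U ∈ 𝓝 s) :
    ∀ᶠ y in 𝓝[>] (0 : ℝ), Icc (α y) (β y) ⊆ U := by
  exact (B.left.tendsto_nhds.Icc B.right.tendsto_nhds).eventually (eventually_smallSets_subset.2 hU)

end ChordBranches

theorem exists_chordBranches {Y : ℝ → ℝ} {s a b : ℝ} (has : a < s) (hsb : s < b)
    (hcont : ContinuousOn Y (Icc a b)) (hanti : StrictAntiOn Y (Icc a s))
    (hmono : StrictMonoOn Y (Icc s b)) (h0 : Y s = 0) : ∃ α β, ChordBranches Y α β s := by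
  set α := Function.invFunOn Y (Icc a s)
  set β := Function.invFunOn Y (Icc s b)
  have hα : ∀ u ∈ Icc a s, α (Y u) = u := fun u hu => hanti.injOn.leftInvOn_invFunOn hu
  have hβ : ∀ u ∈ Icc s b, β (Y u) = u := fun u hu => hmono.injOn.leftInvOn_invFunOn hu
  have Bl : IsBranch Y α s (-1) (𝓝[<] s) := by
    refine ⟨nhdsLT_le_nhdsNE s, ?_, ?_, ?_⟩
    · filter_upwards [self_mem_nhdsWithin] with u hu
      rw [abs_of_neg (sub_neg.2 hu)]; ring
    · rw [← h0]
      exact map_nhdsLT_of_strictAntiOn has (hcont.mono (Icc_subset_Icc_right hsb.le)) hanti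
    · filter_upwards [Ioo_mem_nhdsLT has] with u hu
      filter_upwards [Icc_mem_nhds hu.1 hu.2] using hα
  have Br : IsBranch Y β s 1 (𝓝[>] s) := by
    refine ⟨nhdsGT_le_nhdsNE s, ?_, ?_, ?_⟩
    · filter_upwards [self_mem_nhdsWithin] with u hu
      rw [abs_of_pos (sub_pos.2 hu), one_mul]
    · rw [← h0]
      exact map_nhdsGT_of_strictMonoOn hsb (hcont.mono (Icc_subset_Icc_left has.le)) hmono
    · filter_upwards [Ioo_mem_nhdsGT hsb] with u hu
      filter_upwards [Icc_mem_nhds hu.1 hu.2] using hβ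
  refine ⟨α, β, Bl, Br, ?_⟩
  filter_upwards [Bl.eventually_right_inv, Br.eventually_right_inv,
    Bl.tendsto.eventually (Icc_mem_nhdsLT has), Br.tendsto.eventually (Icc_mem_nhdsGT hsb)]
    with y hl hr hly hry u hu
  rcases le_total u s with hus | hsu
  · exact (hanti hly ⟨hly.1.trans hu.1.le, hus⟩ hu.1).trans_eq hl
  · exact (hmono ⟨hsu, hu.2.le.trans hry.2⟩ hry hu.2).trans_eq hr

/-! ### Chords in osculating coordinates -/

/-- `A` and `Y` behave at `s` like the coordinates of a curve in the affine frame formed by the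
position, the velocity and the acceleration of the curve at `s`. -/
structure IsOsculating (A Y : ℝ → ℝ) (s : ℝ) : Prop where
  contDiffAt_fst : ContDiffAt ℝ 1 A s
  contDiffAt_snd : ContDiffAt ℝ 2 Y s
  fst_self : A s = 0
  deriv_fst_self : deriv A s = 1
  snd_self : Y s = 0
  deriv_snd_self : deriv Y s = 0
  deriv_deriv_snd_self : deriv (deriv Y) s = 1

/-- The length of the chord at height `y`, measured along the velocity vector. -/
def chordLength (A α β : ℝ → ℝ) (y : ℝ) : ℝ := A (β y) - A (α y)

namespace IsOsculating

variable {A Y : ℝ → ℝ} {s : ℝ}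

theorem continuousAt_deriv_fst (h : IsOsculating A Y s) : ContinuousAt (deriv A) s :=
  (h.contDiffAt_fst.derivWithin (m := 0) (by simp)).continuousAt

theorem hasDerivAt_deriv_snd (h : IsOsculating A Y s) : HasDerivAt (deriv Y) 1 s := by
  rw [← h.deriv_deriv_snd_self]
  exact ((h.contDiffAt_snd.derivWithin (m := 1) (by norm_num)).differentiableAt
    one_ne_zero).hasDerivAt

theorem eventually_differentiableAt_fst (h : IsOsculating A Y s) :
    ∀ᶠ u in 𝓝 s, DifferentiableAt ℝ A u :=
  (h.contDiffAt_fst.eventually (by simp)).mono fun _ hu => hu.differentiableAt one_ne_zero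

theorem eventually_contDiffAt_snd (h : IsOsculating A Y s) :
    ∀ᶠ u in 𝓝 s, ContDiffAt ℝ 2 Y u :=
  h.contDiffAt_snd.eventually (by simp)

theorem tendsto_fst_nhds (h : IsOsculating A Y s) : Tendsto A (𝓝 s) (𝓝 0) := by
  have := h.contDiffAt_fst.continuousAt.tendsto
  rwa [h.fst_self] at this

theorem tendsto_snd_nhds (h : IsOsculating A Y s) : Tendsto Y (𝓝 s) (𝓝 0) := by
  have := h.contDiffAt_snd.continuousAt.tendsto
  rwa [h.snd_self] at this

theorem tendsto_fst_div (h : IsOsculating A Y s) :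
    Tendsto (fun u => A u / (u - s)) (𝓝[≠] s) (𝓝 1) := by
  have := (h.contDiffAt_fst.differentiableAt one_ne_zero).hasDerivAt.tendsto_slope
  rw [h.deriv_fst_self] at this
  refine this.congr fun u => ?_
  rw [slope_def_field, h.fst_self, sub_zero]

theorem tendsto_deriv_snd_div (h : IsOsculating A Y s) :
    Tendsto (fun u => deriv Y u / (u - s)) (𝓝[≠] s) (𝓝 1) := by
  refine h.hasDerivAt_deriv_snd.tendsto_slope.congr fun u => ?_
  rw [slope_def_field, h.deriv_snd_self, sub_zero]

theorem tendsto_snd_div_sq (h : IsOsculating A Y s) :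
    Tendsto (fun u => Y u / (u - s) ^ 2) (𝓝[≠] s) (𝓝 (1 / 2)) := by
  have hsq : Tendsto (fun u : ℝ => (u - s) ^ 2) (𝓝 s) (𝓝 0) := by
    have : ContinuousAt (fun u : ℝ => (u - s) ^ 2) s := by fun_prop
    simpa [ContinuousAt] using this
  refine HasDerivAt.lhopital_zero_nhdsNE (f' := deriv Y) (g' := fun u => 2 * (u - s))
    ?_ ?_ ?_ (h.tendsto_snd_nhds.mono_left nhdsWithin_le_nhds)
    (hsq.mono_left nhdsWithin_le_nhds) ?_
  · filter_upwards [nhdsWithin_le_nhds h.eventually_contDiffAt_snd] with u hu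
    exact (hu.differentiableAt two_ne_zero).hasDerivAt
  · refine Eventually.of_forall fun u => ?_
    simpa using ((hasDerivAt_id' u).sub_const s).fun_pow 2
  · filter_upwards [self_mem_nhdsWithin] with u hu
    exact mul_ne_zero two_ne_zero (sub_ne_zero.2 hu)
  · refine (h.tendsto_deriv_snd_div.div_const 2).congr fun u => ?_
    rw [div_div, mul_comm]

theorem eventually_deriv_snd_div_pos (h : IsOsculating A Y s) :
    ∀ᶠ u in 𝓝[≠] s, 0 < deriv Y u / (u - s) :=
  h.tendsto_deriv_snd_div.eventually_const_lt one_pos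

theorem exists_chordBranches (h : IsOsculating A Y s) : ∃ α β, ChordBranches Y α β s := by
  obtain ⟨ε, hε, hball⟩ := Metric.eventually_nhds_iff.1
    (h.eventually_contDiffAt_snd.and (eventually_nhdsWithin_iff.1 h.eventually_deriv_snd_div_pos))
  simp only [Real.dist_eq, abs_lt] at hball
  have hcont : ContinuousOn Y (Icc (s - ε / 2) (s + ε / 2)) := fun u hu =>
    (hball ⟨by linarith [hu.1], by linarith [hu.2]⟩).1.continuousAt.continuousWithinAt
  refine CentroidParabola.exists_chordBranches (by linarith : s - ε / 2 < s)
    (by linarith : s < s + ε / 2) hcont ?_ ?_ h.snd_self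
  · refine strictAntiOn_of_deriv_neg (convex_Icc _ _)
      (hcont.mono (Icc_subset_Icc_right (by linarith))) fun u hu => ?_
    rw [interior_Icc] at hu
    have := (hball ⟨by linarith [hu.1], by linarith [hu.2]⟩).2 hu.2.ne
    exact ((div_pos_iff.1 this).resolve_left fun hpos => hpos.2.not_gt (sub_neg.2 hu.2)).1
  · refine strictMonoOn_of_deriv_pos (convex_Icc _ _)
      (hcont.mono (Icc_subset_Icc_left (by linarith))) fun u hu => ?_
    rw [interior_Icc] at hu
    have := (hball ⟨by linarith [hu.1], by linarith [hu.2]⟩).2 hu.1.ne'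
    rwa [div_pos_iff_of_pos_right (sub_pos.2 hu.1)] at this

section Branch

variable {γ : ℝ → ℝ} {σ : ℝ} {l : Filter ℝ}

theorem tendsto_sub_div_sqrt (h : IsOsculating A Y s) (B : IsBranch Y γ s σ l) :
    Tendsto (fun u => (u - s) / √(Y u)) l (𝓝 (σ * √2)) := by
  have hlim := (h.tendsto_snd_div_sq.mono_left B.le_punctured).inv₀ (by norm_num)
  rw [one_div, inv_inv] at hlim
  replace hlim := hlim.sqrt.const_mul σ
  refine hlim.congr' ?_
  filter_upwards [B.sub_eq] with u hu
  rw [inv_div, Real.sqrt_div (sq_nonneg _), Real.sqrt_sq_eq_abs, mul_div_assoc', ← hu]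

theorem tendsto_fst_div_sqrt (h : IsOsculating A Y s) (B : IsBranch Y γ s σ l) :
    Tendsto (fun u => A u / √(Y u)) l (𝓝 (σ * √2)) := by
  have hlim := (h.tendsto_fst_div.mono_left B.le_punctured).mul (h.tendsto_sub_div_sqrt B)
  rw [one_mul] at hlim
  refine hlim.congr' ?_
  filter_upwards [B.le_punctured self_mem_nhdsWithin] with u hu
  exact div_mul_div_cancel₀ (sub_ne_zero.2 hu)

theorem tendsto_deriv_div_mul_sqrt (h : IsOsculating A Y s) (B : IsBranch Y γ s σ l) :
    Tendsto (fun u => deriv A u / deriv Y u * √(Y u)) l (𝓝 (σ / √2)) := by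
  have hσ : σ ≠ 0 := fun h0 => by simpa [h0] using B.sign_sq_eq_one
  have hA : Tendsto (deriv A) l (𝓝 1) := by
    have := h.continuousAt_deriv_fst.tendsto
    rw [h.deriv_fst_self] at this
    exact this.mono_left (B.le_punctured.trans nhdsWithin_le_nhds)
  have hlim := hA.div ((h.tendsto_deriv_snd_div.mono_left B.le_punctured).mul
    (h.tendsto_sub_div_sqrt B)) (by positivity)
  have hval : 1 / (1 * (σ * √2)) = σ / √2 := by
    field_simp
    linear_combination -B.sign_sq_eq_one
  rw [hval] at hlim
  refine hlim.congr' ?_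
  filter_upwards [B.le_punctured self_mem_nhdsWithin] with u hu
  rw [Pi.div_apply, div_mul_div_cancel₀ (sub_ne_zero.2 hu), div_div_eq_mul_div, div_mul_eq_mul_div]

theorem tendsto_comp_div_sqrt (h : IsOsculating A Y s) (B : IsBranch Y γ s σ l) :
    Tendsto (fun y => A (γ y) / √y) (𝓝[>] 0) (𝓝 (σ * √2)) := by
  refine B.tendsto_iff.2 ((h.tendsto_fst_div_sqrt B).congr' ?_)
  filter_upwards [B.eventually_left_inv] with u hu
  rw [hu]

theorem tendsto_deriv_div_comp_mul_sqrt (h : IsOsculating A Y s) (B : IsBranch Y γ s σ l) :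
    Tendsto (fun y => deriv A (γ y) / deriv Y (γ y) * √y) (𝓝[>] 0) (𝓝 (σ / √2)) := by
  refine B.tendsto_iff.2 ((h.tendsto_deriv_div_mul_sqrt B).congr' ?_)
  filter_upwards [B.eventually_left_inv] with u hu
  rw [hu]

theorem eventually_hasDerivAt_comp (h : IsOsculating A Y s) (B : IsBranch Y γ s σ l) :
    ∀ᶠ y in 𝓝[>] 0, HasDerivAt (fun y => A (γ y)) (deriv A (γ y) / deriv Y (γ y)) y := by
  rw [B.eventually_iff]
  filter_upwards [B.left_inv, B.eventually_left_inv,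
    (B.le_punctured.trans nhdsWithin_le_nhds) h.eventually_contDiffAt_snd,
    (B.le_punctured.trans nhdsWithin_le_nhds) h.eventually_differentiableAt_fst,
    B.le_punctured h.eventually_deriv_snd_div_pos] with u hinv hu hY hA hpos
  have hne : deriv Y u ≠ 0 := fun h0 => by simp [h0] at hpos
  have hγ := ((hY.hasStrictDerivAt two_ne_zero).to_local_left_inverse hne hinv).hasDerivAt
  rw [hu, div_eq_mul_inv]
  exact HasDerivAt.comp (h := γ) (Y u) (by rw [hu]; exact hA.hasDerivAt) hγ

/-- The sign of the root is forced by the side on which the branch lies. -/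
theorem eventually_sq_eq_iff (h : IsOsculating A Y s) (B : IsBranch Y γ s σ l) (ρ : ℝ) :
    (∀ᶠ u in l, (A u + ρ * Y u) ^ 2 = 2 * Y u) ↔
      ∀ᶠ y in 𝓝[>] 0, A (γ y) + ρ * y = σ * √2 * √y := by
  rw [B.eventually_iff]
  constructor
  · intro hsq
    have hroot : Tendsto (fun u => √(Y u)) l (𝓝 0) := by
      simpa using (h.tendsto_snd_nhds.mono_left
        (B.le_punctured.trans nhdsWithin_le_nhds)).sqrt
    have hlim := ((h.tendsto_fst_div_sqrt B).add (hroot.const_mul ρ)).const_mul σ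
    have hval : σ * (σ * √2 + ρ * 0) = √2 := by linear_combination √2 * B.sign_sq_eq_one
    rw [hval] at hlim
    filter_upwards [hsq, hlim.eventually_const_lt (by positivity : 0 < √2),
      B.eventually_left_inv, B.eventually_height_pos] with u hu hsign hinv hpos
    have hY : √(Y u) ^ 2 = Y u := Real.sq_sqrt hpos.le
    have hnonneg : 0 ≤ σ * (A u + ρ * Y u) := by
      have := mul_pos hsign (Real.sqrt_pos.2 hpos)
      field_simp at this
      rw [hY] at this
      linarith
    have hroot_eq : σ * (A u + ρ * Y u) = √2 * √(Y u) := by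
      rw [← sq_eq_sq₀ hnonneg (by positivity), mul_pow, mul_pow, B.sign_sq_eq_one, hu, hY,
        Real.sq_sqrt zero_le_two, one_mul]
    rw [hinv]
    linear_combination σ * hroot_eq - (A u + ρ * Y u) * B.sign_sq_eq_one
  · intro hroot
    filter_upwards [hroot, B.eventually_left_inv, B.eventually_height_pos] with u hu hinv hpos
    rw [hinv] at hu
    rw [hu, mul_pow, mul_pow, B.sign_sq_eq_one, Real.sq_sqrt zero_le_two, Real.sq_sqrt hpos.le]
    ring

end Branch

section Chords

variable {α β : ℝ → ℝ}

theorem eventually_hasDerivAt_chordLength (h : IsOsculating A Y s) (B : ChordBranches Y α β s) :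
    ∀ᶠ y in 𝓝[>] 0, HasDerivAt (chordLength A α β)
      (deriv A (β y) / deriv Y (β y) - deriv A (α y) / deriv Y (α y)) y := by
  filter_upwards [h.eventually_hasDerivAt_comp B.left, h.eventually_hasDerivAt_comp B.right]
    with y hl hr using hr.sub hl

theorem tendsto_chordLength_div_sqrt (h : IsOsculating A Y s) (B : ChordBranches Y α β s) :
    Tendsto (fun y => chordLength A α β y / √y) (𝓝[>] 0) (𝓝 (2 * √2)) := by
  have hlim := (h.tendsto_comp_div_sqrt B.right).sub (h.tendsto_comp_div_sqrt B.left)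
  have hval : 1 * √2 - -1 * √2 = 2 * √2 := by ring
  rw [hval] at hlim
  exact hlim.congr fun y => (sub_div _ _ _).symm

theorem tendsto_deriv_chordLength_mul_sqrt (h : IsOsculating A Y s)
    (B : ChordBranches Y α β s) :
    Tendsto (fun y => deriv (chordLength A α β) y * √y) (𝓝[>] 0) (𝓝 √2) := by
  have hlim := (h.tendsto_deriv_div_comp_mul_sqrt B.right).sub
    (h.tendsto_deriv_div_comp_mul_sqrt B.left)
  have hval : 1 / √2 - -1 / √2 = √2 := by
    field_simp
    norm_num
  rw [hval] at hlim
  refine hlim.congr' ?_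
  filter_upwards [h.eventually_hasDerivAt_chordLength B] with y hy
  rw [hy.deriv, sub_mul]

theorem eventually_chordLength_pos (h : IsOsculating A Y s) (B : ChordBranches Y α β s) :
    ∀ᶠ y in 𝓝[>] 0, 0 < chordLength A α β y := by
  filter_upwards [(h.tendsto_chordLength_div_sqrt B).eventually_const_lt
    (by positivity : 0 < 2 * √2), self_mem_nhdsWithin] with y hy hy0
  rwa [div_pos_iff_of_pos_right (Real.sqrt_pos.2 hy0)] at hy

theorem eventually_deriv_chordLength_pos (h : IsOsculating A Y s) (B : ChordBranches Y α β s) :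
    ∀ᶠ y in 𝓝[>] 0, 0 < deriv (chordLength A α β) y := by
  filter_upwards [(h.tendsto_deriv_chordLength_mul_sqrt B).eventually_const_lt
    (by positivity : 0 < √2)] with y hy
  exact pos_of_mul_pos_left hy (Real.sqrt_nonneg y)

theorem tendsto_chordLength_div_deriv_div (h : IsOsculating A Y s) (B : ChordBranches Y α β s) :
    Tendsto (fun y => chordLength A α β y / deriv (chordLength A α β) y / y) (𝓝[>] 0) (𝓝 2) := by
  have h2 : √2 ≠ 0 := by positivity
  have hlim := (h.tendsto_chordLength_div_sqrt B).div (h.tendsto_deriv_chordLength_mul_sqrt B) h2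
  rw [mul_div_cancel_right₀ _ h2] at hlim
  refine hlim.congr' ?_
  filter_upwards [self_mem_nhdsWithin] with y hy
  have hsq : √y * √y = y := Real.mul_self_sqrt (le_of_lt hy)
  rw [Pi.div_apply, div_div, mul_left_comm, hsq, ← div_div]

theorem eventually_chordLength_sq_iff (h : IsOsculating A Y s) (B : ChordBranches Y α β s) :
    (∀ᶠ y in 𝓝[>] 0, chordLength A α β y ^ 2 = 8 * y) ↔
      ∀ᶠ y in 𝓝[>] 0, chordLength A α β y = 2 * y * deriv (chordLength A α β) y := by
  refine eventually_sq_eq_mul_iff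
    ((h.eventually_hasDerivAt_chordLength B).mono fun _ hy => hy.differentiableAt)
    ((h.eventually_chordLength_pos B).mono fun _ hy => hy.ne') ?_
  have hlim := (h.tendsto_chordLength_div_sqrt B).pow 2
  rw [mul_pow, Real.sq_sqrt zero_le_two] at hlim
  norm_num at hlim
  refine hlim.congr' ?_
  filter_upwards [self_mem_nhdsWithin] with y hy
  rw [div_pow, Real.sq_sqrt (le_of_lt hy)]

theorem eventually_chordLength_sq_iff_eq_sqrt (h : IsOsculating A Y s)
    (B : ChordBranches Y α β s) :
    (∀ᶠ y in 𝓝[>] 0, chordLength A α β y ^ 2 = 8 * y) ↔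
      ∀ᶠ y in 𝓝[>] 0, chordLength A α β y = 2 * √2 * √y := by
  refine eventually_congr ?_
  filter_upwards [h.eventually_chordLength_pos B, self_mem_nhdsWithin] with y hL hy
  rw [← sq_eq_sq₀ hL.le (by positivity), mul_pow, mul_pow, Real.sq_sqrt zero_le_two,
    Real.sq_sqrt (le_of_lt hy)]
  norm_num

theorem eventually_chordLength_sq (h : IsOsculating A Y s) (B : ChordBranches Y α β s) {ρ : ℝ}
    (hpar : ∀ᶠ u in 𝓝 s, (A u + ρ * Y u) ^ 2 = 2 * Y u) :
    ∀ᶠ y in 𝓝[>] 0, chordLength A α β y ^ 2 = 8 * y := by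
  rw [h.eventually_chordLength_sq_iff_eq_sqrt B]
  filter_upwards [(h.eventually_sq_eq_iff B.left ρ).1 (nhdsWithin_le_nhds hpar),
    (h.eventually_sq_eq_iff B.right ρ).1 (nhdsWithin_le_nhds hpar)] with y hl hr
  rw [chordLength]
  linear_combination hr - hl

theorem eventually_sq_eq_nhds (h : IsOsculating A Y s) (B : ChordBranches Y α β s) {ρ : ℝ}
    (hchord : ∀ᶠ y in 𝓝[>] 0, chordLength A α β y ^ 2 = 8 * y)
    (hside : (∀ᶠ u in 𝓝[<] s, (A u + ρ * Y u) ^ 2 = 2 * Y u) ∨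
      ∀ᶠ u in 𝓝[>] s, (A u + ρ * Y u) ^ 2 = 2 * Y u) :
    ∀ᶠ u in 𝓝 s, (A u + ρ * Y u) ^ 2 = 2 * Y u := by
  rw [h.eventually_chordLength_sq_iff_eq_sqrt B] at hchord
  have hiff : (∀ᶠ u in 𝓝[<] s, (A u + ρ * Y u) ^ 2 = 2 * Y u) ↔
      ∀ᶠ u in 𝓝[>] s, (A u + ρ * Y u) ^ 2 = 2 * Y u := by
    rw [h.eventually_sq_eq_iff B.left, h.eventually_sq_eq_iff B.right]
    refine eventually_congr ?_
    filter_upwards [hchord] with y hy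
    rw [chordLength] at hy
    constructor <;> intro hroot
    · linear_combination hroot + hy
    · linear_combination hroot - hy
  have hleft := hside.elim id hiff.2
  rw [← nhdsNE_sup_pure s, ← nhdsLT_sup_nhdsGT, eventually_sup, eventually_sup, eventually_pure]
  refine ⟨⟨hleft, hiff.1 hleft⟩, ?_⟩
  simp [h.fst_self, h.snd_self]

end Chords

end IsOsculating

/-! ### The frame of velocity and acceleration -/

/-- The component along the velocity of `X` at `s` of a vector expanded in the frame of velocity
and acceleration. -/
def tangentPart (X : ℝ → Plane) (s : ℝ) : Plane →L[ℝ] ℝ :=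
  (wedge (deriv X s) (deriv (deriv X) s))⁻¹ • wedge.flip (deriv (deriv X) s)

/-- The component along the acceleration of `X` at `s` of a vector expanded in the frame of
velocity and acceleration. -/
def heightPart (X : ℝ → Plane) (s : ℝ) : Plane →L[ℝ] ℝ :=
  (wedge (deriv X s) (deriv (deriv X) s))⁻¹ • wedge (deriv X s)

/-- The coordinate along the velocity of the point `X u` in the affine frame of `X` at `s`. -/
def abscissa (X : ℝ → Plane) (s u : ℝ) : ℝ := tangentPart X s (X u - X s)

/-- The coordinate along the acceleration of the point `X u` in the affine frame of `X` at `s`.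
Lines parallel to the tangent line at `s` are level sets of this coordinate. -/
def height (X : ℝ → Plane) (s u : ℝ) : ℝ := heightPart X s (X u - X s)

/-- `X` is a `C^3` curve on the open set `I` whose velocity and acceleration are everywhere
linearly independent. -/
structure IsNondegenerateOn (X : ℝ → Plane) (I : Set ℝ) : Prop where
  isOpen : IsOpen I
  contDiffOn : ContDiffOn ℝ 3 X I
  wedge_ne_zero : ∀ s ∈ I, wedge (deriv X s) (deriv (deriv X) s) ≠ 0

section Frame

variable {X : ℝ → Plane} {s : ℝ}

theorem tangentPart_apply (X : ℝ → Plane) (s : ℝ) (v : Plane) :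
    tangentPart X s v =
      wedge v (deriv (deriv X) s) / wedge (deriv X s) (deriv (deriv X) s) := by
  simp [tangentPart, div_eq_inv_mul]

theorem heightPart_apply (X : ℝ → Plane) (s : ℝ) (v : Plane) :
    heightPart X s v = wedge (deriv X s) v / wedge (deriv X s) (deriv (deriv X) s) := by
  simp [heightPart, div_eq_inv_mul]

theorem heightPart_velocity (X : ℝ → Plane) (s : ℝ) : heightPart X s (deriv X s) = 0 := by
  rw [heightPart_apply, wedge_self, zero_div]

theorem tangentPart_acceleration (X : ℝ → Plane) (s : ℝ) :
    tangentPart X s (deriv (deriv X) s) = 0 := by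
  rw [tangentPart_apply, wedge_self, zero_div]

theorem tangentPart_velocity (hD : wedge (deriv X s) (deriv (deriv X) s) ≠ 0) :
    tangentPart X s (deriv X s) = 1 := by
  rw [tangentPart_apply, div_self hD]

theorem heightPart_acceleration (hD : wedge (deriv X s) (deriv (deriv X) s) ≠ 0) :
    heightPart X s (deriv (deriv X) s) = 1 := by
  rw [heightPart_apply, div_self hD]

theorem frame_decomposition (hD : wedge (deriv X s) (deriv (deriv X) s) ≠ 0) (v : Plane) :
    v = tangentPart X s v • deriv X s + heightPart X s v • deriv (deriv X) s := by
  rw [tangentPart_apply, heightPart_apply, div_eq_inv_mul, div_eq_inv_mul, mul_smul, mul_smul,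
    ← smul_add, ← wedge_smul_eq, inv_smul_smul₀ hD]

theorem wedge_eq_mul (hD : wedge (deriv X s) (deriv (deriv X) s) ≠ 0) (v w : Plane) :
    wedge v w = wedge (deriv X s) (deriv (deriv X) s) *
      (tangentPart X s v * heightPart X s w - heightPart X s v * tangentPart X s w) := by
  conv_lhs => rw [frame_decomposition hD v, frame_decomposition hD w]
  simp only [map_add, map_smul, add_apply, smul_apply, smul_eq_mul, wedge_self,
    wedge_swap (deriv X s) (deriv (deriv X) s)]
  ring

end Frame

namespace IsNondegenerateOn

variable {X : ℝ → Plane} {I : Set ℝ} {s u : ℝ}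

theorem mem_nhds (hX : IsNondegenerateOn X I) (hs : s ∈ I) : I ∈ 𝓝 s := hX.isOpen.mem_nhds hs

theorem contDiffAt (hX : IsNondegenerateOn X I) (hs : s ∈ I) : ContDiffAt ℝ 3 X s :=
  hX.contDiffOn.contDiffAt (hX.mem_nhds hs)

theorem contDiffAt_deriv (hX : IsNondegenerateOn X I) (hs : s ∈ I) :
    ContDiffAt ℝ 2 (deriv X) s :=
  (hX.contDiffAt hs).derivWithin (by norm_num)

theorem contDiffAt_deriv_deriv (hX : IsNondegenerateOn X I) (hs : s ∈ I) :
    ContDiffAt ℝ 1 (deriv (deriv X)) s :=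
  (hX.contDiffAt_deriv hs).derivWithin (by norm_num)

theorem hasDerivAt (hX : IsNondegenerateOn X I) (hs : s ∈ I) : HasDerivAt X (deriv X s) s :=
  ((hX.contDiffAt hs).differentiableAt three_ne_zero).hasDerivAt

theorem hasDerivAt_deriv (hX : IsNondegenerateOn X I) (hs : s ∈ I) :
    HasDerivAt (deriv X) (deriv (deriv X) s) s :=
  ((hX.contDiffAt_deriv hs).differentiableAt two_ne_zero).hasDerivAt

theorem hasDerivAt_deriv_deriv (hX : IsNondegenerateOn X I) (hs : s ∈ I) :
    HasDerivAt (deriv (deriv X)) (deriv (deriv (deriv X)) s) s :=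
  ((hX.contDiffAt_deriv_deriv hs).differentiableAt one_ne_zero).hasDerivAt

theorem deriv_abscissa (hX : IsNondegenerateOn X I) (s : ℝ) (hu : u ∈ I) :
    deriv (abscissa X s) u = tangentPart X s (deriv X u) :=
  ((tangentPart X s).hasFDerivAt.comp_hasDerivAt u ((hX.hasDerivAt hu).sub_const (X s))).deriv

theorem hasDerivAt_height (hX : IsNondegenerateOn X I) (s : ℝ) (hu : u ∈ I) :
    HasDerivAt (height X s) (heightPart X s (deriv X u)) u :=
  (heightPart X s).hasFDerivAt.comp_hasDerivAt u ((hX.hasDerivAt hu).sub_const (X s))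

theorem deriv_height (hX : IsNondegenerateOn X I) (s : ℝ) (hu : u ∈ I) :
    deriv (height X s) u = heightPart X s (deriv X u) :=
  (hX.hasDerivAt_height s hu).deriv

theorem isOsculating (hX : IsNondegenerateOn X I) (hs : s ∈ I) :
    IsOsculating (abscissa X s) (height X s) s where
  contDiffAt_fst := ((tangentPart X s).contDiff.contDiffAt.comp s
    ((hX.contDiffAt hs).sub contDiffAt_const)).of_le (by norm_num)
  contDiffAt_snd := ((heightPart X s).contDiff.contDiffAt.comp s
    ((hX.contDiffAt hs).sub contDiffAt_const)).of_le (by norm_num)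
  fst_self := by rw [abscissa, sub_self, map_zero]
  deriv_fst_self := by rw [hX.deriv_abscissa s hs, tangentPart_velocity (hX.wedge_ne_zero s hs)]
  snd_self := by rw [height, sub_self, map_zero]
  deriv_snd_self := by rw [hX.deriv_height s hs, heightPart_velocity]
  deriv_deriv_snd_self := by
    have hev : deriv (height X s) =ᶠ[𝓝 s] heightPart X s ∘ deriv X := by
      filter_upwards [hX.mem_nhds hs] with u hu using hX.deriv_height s hu
    rw [hev.deriv_eq, ((heightPart X s).hasFDerivAt.comp_hasDerivAt s
      (hX.hasDerivAt_deriv hs)).deriv, heightPart_acceleration (hX.wedge_ne_zero s hs)]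

theorem exists_chordBranches (hX : IsNondegenerateOn X I) (hs : s ∈ I) :
    ∃ α β, ChordBranches (height X s) α β s :=
  (hX.isOsculating hs).exists_chordBranches

end IsNondegenerateOn

/-! ### The centroid distance in terms of the chord length -/

section TangentTriangle

variable {X : ℝ → Plane} {s a b : ℝ}

theorem tangentPart_eq_mul_of_mem_tangentLine {p : Plane} (hp : p ∈ tangentLine X a)
    (ha : heightPart X s (deriv X a) ≠ 0) :
    tangentPart X s (p - X a) = heightPart X s (p - X a) *
      (tangentPart X s (deriv X a) / heightPart X s (deriv X a)) := by
  obtain ⟨r, rfl⟩ := mem_lineThrough_iff_exists.1 hp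
  simp only [add_sub_cancel_left, map_smul, smul_eq_mul]
  field_simp

/-- The abscissas of `X a` and `X b` are both obtained from that of `Q` by descending along the
tangent lines, and their difference is the length of the chord. -/
theorem heightPart_tangentLine_inter {Q : Plane} (hQa : Q ∈ tangentLine X a)
    (hQb : Q ∈ tangentLine X b) (hab : height X s a = height X s b)
    (ha : heightPart X s (deriv X a) ≠ 0) (hb : heightPart X s (deriv X b) ≠ 0)
    (hne : tangentPart X s (deriv X b) / heightPart X s (deriv X b) -
      tangentPart X s (deriv X a) / heightPart X s (deriv X a) ≠ 0) :
    heightPart X s (Q - X s) = height X s a - (abscissa X s b - abscissa X s a) /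
      (tangentPart X s (deriv X b) / heightPart X s (deriv X b) -
        tangentPart X s (deriv X a) / heightPart X s (deriv X a)) := by
  have hAa := tangentPart_eq_mul_of_mem_tangentLine hQa ha
  have hAb := tangentPart_eq_mul_of_mem_tangentLine hQb hb
  rw [eq_sub_iff_add_eq, ← eq_sub_iff_add_eq', div_eq_iff hne]
  simp only [height, abscissa, map_sub] at hab hAa hAb ⊢
  linear_combination hAa - hAb -
    tangentPart X s (deriv X b) / heightPart X s (deriv X b) * hab

theorem wedge_velocity_ne_zero (hD : wedge (deriv X s) (deriv (deriv X) s) ≠ 0)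
    (ha : heightPart X s (deriv X a) ≠ 0) (hb : heightPart X s (deriv X b) ≠ 0)
    (hne : tangentPart X s (deriv X b) / heightPart X s (deriv X b) -
      tangentPart X s (deriv X a) / heightPart X s (deriv X a) ≠ 0) :
    wedge (deriv X a) (deriv X b) ≠ 0 := by
  rw [wedge_eq_mul hD]
  refine mul_ne_zero hD fun h => hne ?_
  rw [div_sub_div _ _ hb ha, div_eq_zero_iff]
  left
  linear_combination -h

theorem wedge_velocity_self_ne_zero (ha : heightPart X s (deriv X a) ≠ 0) :
    wedge (deriv X a) (deriv X s) ≠ 0 := by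
  rw [wedge_swap, neg_ne_zero]
  intro h
  simp [heightPart_apply, h] at ha

theorem heightPart_of_mem_tangentLine {p : Plane} (hp : p ∈ tangentLine X s) :
    heightPart X s (p - X s) = 0 := by
  obtain ⟨r, rfl⟩ := mem_lineThrough_iff_exists.1 hp
  rw [add_sub_cancel_left, map_smul, heightPart_velocity, smul_zero]

theorem heightPart_centroid (X : ℝ → Plane) (s : ℝ) (P Q R : Plane) :
    heightPart X s (Finset.univ.centroid ℝ ![P, Q, R] - X s) =
      (heightPart X s (P - X s) + heightPart X s (Q - X s) + heightPart X s (R - X s)) / 3 := by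
  simp only [centroid_triangle, map_sub, map_add, map_smul, smul_eq_mul]
  ring

end TangentTriangle

/-- The component of the acceleration of `X` at `s` along the normal `N s`; it converts heights
in the frame of velocity and acceleration into distances from the tangent line. -/
def normalAcceleration (X N : ℝ → Plane) (s : ℝ) : ℝ := inner ℝ (deriv (deriv X) s) (N s)

namespace IsStrictlyLocallyConvex

variable {X N : ℝ → Plane} {I : Set ℝ} {s : ℝ}

theorem normalAcceleration_pos (hX : IsStrictlyLocallyConvex X I N) (hs : s ∈ I) :
    0 < normalAcceleration X N s := by
  have hT : 0 < ‖deriv X s‖ := norm_pos_iff.2 (hX.regular s hs)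
  exact (div_pos_iff_of_pos_right (by positivity)).1 (hX.curvature_pos s hs)

theorem abs_wedge_normal (hX : IsStrictlyLocallyConvex X I N) (hs : s ∈ I) :
    |wedge (deriv X s) (N s)| = ‖deriv X s‖ := by
  rw [abs_wedge_eq_of_inner_eq_zero (hX.normal s hs).inner_eq_zero, (hX.normal s hs).norm_eq_one,
    mul_one]

theorem wedge_normal_ne_zero (hX : IsStrictlyLocallyConvex X I N) (hs : s ∈ I) :
    wedge (deriv X s) (N s) ≠ 0 := by
  rw [← abs_ne_zero, hX.abs_wedge_normal hs]
  exact norm_ne_zero_iff.2 (hX.regular s hs)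

theorem wedge_eq (hX : IsStrictlyLocallyConvex X I N) (hs : s ∈ I) :
    wedge (deriv X s) (deriv (deriv X) s) =
      wedge (deriv X s) (N s) * normalAcceleration X N s := by
  have hprod := inner_mul_inner_sub (deriv X s) (deriv (deriv X) s) (deriv X s) (N s)
  rw [(hX.normal s hs).inner_eq_zero, zero_mul, sub_zero, real_inner_self_eq_norm_sq,
    ← hX.abs_wedge_normal hs, sq_abs] at hprod
  refine mul_right_cancel₀ (hX.wedge_normal_ne_zero hs) ?_
  rw [← hprod, normalAcceleration]
  ring

theorem isNondegenerateOn (hX : IsStrictlyLocallyConvex X I N) (hI : IsOpen I) :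
    IsNondegenerateOn X I where
  isOpen := hI
  contDiffOn := hX.contDiffOn
  wedge_ne_zero s hs := by
    rw [hX.wedge_eq hs]
    exact mul_ne_zero (hX.wedge_normal_ne_zero hs) (hX.normalAcceleration_pos hs).ne'

theorem wedge_sub_chordLine (hX : IsStrictlyLocallyConvex X I N) (hs : s ∈ I) (y : ℝ)
    (p : Plane) :
    wedge (deriv X s) (p - (X s + (normalAcceleration X N s * y) • N s)) =
      wedge (deriv X s) (N s) *
        (normalAcceleration X N s * (heightPart X s (p - X s) - y)) := by
  have hκ := (hX.normalAcceleration_pos hs).ne'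
  have hW := hX.wedge_normal_ne_zero hs
  rw [heightPart_apply, hX.wedge_eq hs, ← sub_sub, map_sub, map_smul, smul_eq_mul]
  field_simp

theorem mem_chordLine_iff (hX : IsStrictlyLocallyConvex X I N) (hs : s ∈ I) {y : ℝ} {p : Plane} :
    p ∈ chordLine X N s (normalAcceleration X N s * y) ↔ heightPart X s (p - X s) = y := by
  rw [chordLine, mem_lineThrough_iff (hX.regular s hs), hX.wedge_sub_chordLine hs,
    mul_eq_zero_iff_left (hX.wedge_normal_ne_zero hs),
    mul_eq_zero_iff_left (hX.normalAcceleration_pos hs).ne', sub_eq_zero]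

theorem infDist_chordLine (hX : IsStrictlyLocallyConvex X I N) (hs : s ∈ I) (y : ℝ) (p : Plane) :
    Metric.infDist p (chordLine X N s (normalAcceleration X N s * y)) =
      normalAcceleration X N s * |heightPart X s (p - X s) - y| := by
  rw [chordLine, infDist_lineThrough (hX.regular s hs), hX.wedge_sub_chordLine hs, abs_mul,
    hX.abs_wedge_normal hs, mul_div_cancel_left₀ _ (norm_ne_zero_iff.2 (hX.regular s hs)),
    abs_mul, abs_of_pos (hX.normalAcceleration_pos hs)]

variable {α β : ℝ → ℝ}

theorem eventually_isChord_iff (hX : IsStrictlyLocallyConvex X I N) (hI : I ∈ 𝓝 s)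
    (B : ChordBranches (height X s) α β s) :
    ∀ᶠ y in 𝓝[>] 0, ∀ a b,
      IsChord X I N s (normalAcceleration X N s * y) a b ↔ a = α y ∧ b = β y := by
  have hs := mem_of_mem_nhds hI
  filter_upwards [B.left.eventually_right_inv, B.right.eventually_right_inv, B.eventually_lt,
    B.eventually_left_lt, B.eventually_lt_right, B.eventually_Icc_subset hI]
    with y hα hβ hlt hαs hsβ hsub a b
  constructor
  · intro h
    have ha := (hX.mem_chordLine_iff hs).1 h.left_mem
    have hb := (hX.mem_chordLine_iff hs).1 h.right_mem
    have hne : ∀ u ∈ Ioo a b, height X s u ≠ y := fun u hu =>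
      mt (hX.mem_chordLine_iff hs).2 (h.notMem u hu)
    have hαa : α y ≤ a := le_of_not_gt fun hlt' => hne _ ⟨hlt', hαs.trans h.lt_right⟩ hα
    have hbβ : b ≤ β y := le_of_not_gt fun hlt' => hne _ ⟨h.left_lt.trans hsβ, hlt'⟩ hβ
    refine ⟨(hαa.eq_of_not_lt fun hlt' => ?_).symm, hbβ.eq_of_not_lt fun hlt' => ?_⟩
    · exact (hlt a ⟨hlt', h.left_lt.trans hsβ⟩).ne ha
    · exact (hlt b ⟨hαs.trans h.lt_right, hlt'⟩).ne hb
  · rintro ⟨rfl, rfl⟩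
    exact ⟨hαs, hsβ, hsub, (hX.mem_chordLine_iff hs).2 hα, (hX.mem_chordLine_iff hs).2 hβ,
      fun u hu hm => (hlt u hu).ne ((hX.mem_chordLine_iff hs).1 hm)⟩

end IsStrictlyLocallyConvex

namespace IsNondegenerateOn

variable {X : ℝ → Plane} {I : Set ℝ} {s σ : ℝ} {α β γ : ℝ → ℝ} {l : Filter ℝ}

theorem eventually_heightPart_ne_zero (hX : IsNondegenerateOn X I) (hs : s ∈ I)
    (B : IsBranch (height X s) γ s σ l) :
    ∀ᶠ y in 𝓝[>] 0, heightPart X s (deriv X (γ y)) ≠ 0 := by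
  refine B.tendsto.eventually (p := fun u => heightPart X s (deriv X u) ≠ 0) ?_
  filter_upwards [B.le_punctured (hX.isOsculating hs).eventually_deriv_snd_div_pos,
    (B.le_punctured.trans nhdsWithin_le_nhds) (hX.mem_nhds hs)] with u hpos hu h0
  simp [hX.deriv_height s hu, h0] at hpos

theorem eventually_deriv_chordLength (hX : IsNondegenerateOn X I) (hs : s ∈ I)
    (B : ChordBranches (height X s) α β s) :
    ∀ᶠ y in 𝓝[>] 0, deriv (chordLength (abscissa X s) α β) y =
      tangentPart X s (deriv X (β y)) / heightPart X s (deriv X (β y)) -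
        tangentPart X s (deriv X (α y)) / heightPart X s (deriv X (α y)) := by
  filter_upwards [(hX.isOsculating hs).eventually_hasDerivAt_chordLength B,
    B.left.tendsto_nhds (hX.mem_nhds hs), B.right.tendsto_nhds (hX.mem_nhds hs)] with y hL hα hβ
  rw [hL.deriv, hX.deriv_abscissa s hα, hX.deriv_abscissa s hβ, hX.deriv_height s hα,
    hX.deriv_height s hβ]

end IsNondegenerateOn

theorem eventually_nhdsGT_zero_mul_left_iff {r : ℝ} (hr : 0 < r) {p : ℝ → Prop} :
    (∀ᶠ y in 𝓝[>] 0, p (r * y)) ↔ ∀ᶠ h in 𝓝[>] 0, p h := by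
  refine ⟨fun h => ?_, eventually_nhdsGT_zero_mul_left hr⟩
  simpa only [mul_inv_cancel_left₀ hr.ne'] using eventually_nhdsGT_zero_mul_left (inv_pos.2 hr) h

/-- Replacing `x` by `2 * x` multiplies the function by `2 ^ r` but does not change its limit. -/
theorem eq_zero_of_tendsto_mul_rpow {b c r : ℝ} (hb : b ≠ 0)
    (h : Tendsto (fun x : ℝ => c * x ^ r) (𝓝[>] 0) (𝓝 b)) : r = 0 := by
  have hdouble : Tendsto (fun x : ℝ => 2 ^ r * (c * x ^ r)) (𝓝[>] 0) (𝓝 b) := by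
    have hscale : Tendsto (fun x : ℝ => 2 * x) (𝓝[>] 0) (𝓝[>] 0) := fun _ hU =>
      eventually_nhdsGT_zero_mul_left two_pos hU
    refine (h.comp hscale).congr' ?_
    filter_upwards [self_mem_nhdsWithin] with x hx
    rw [Function.comp_apply, Real.mul_rpow two_pos.le (le_of_lt hx), mul_left_comm]
  have hlim : (2 : ℝ) ^ r * b = b := tendsto_nhds_unique (h.const_mul _) hdouble
  rwa [mul_eq_right₀ hb, ← Real.rpow_zero 2, Real.rpow_right_inj two_pos (by norm_num)] at hlim

namespace IsStrictlyLocallyConvex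

variable {X N : ℝ → Plane} {I : Set ℝ} {s : ℝ} {α β : ℝ → ℝ}

theorem infDist_centroid_chordLine (hX : IsStrictlyLocallyConvex X I N) (hs : s ∈ I)
    {y : ℝ} (hy : 0 ≤ y) {Q A₁ B₁ : Plane} (hA : A₁ ∈ tangentLine X s)
    (hB : B₁ ∈ tangentLine X s) (hQ : heightPart X s (Q - X s) ≤ y) :
    Metric.infDist (Finset.univ.centroid ℝ ![Q, A₁, B₁])
        (chordLine X N s (normalAcceleration X N s * y)) =
      normalAcceleration X N s * (y - heightPart X s (Q - X s) / 3) := by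
  rw [hX.infDist_chordLine hs, heightPart_centroid, heightPart_of_mem_tangentLine hA,
    heightPart_of_mem_tangentLine hB, abs_of_nonpos (by linarith)]
  ring

/-- The tangent lines at the ends of the chord at height `y` meet at height `y - L / L'`, where
`L` is the length of the chord as a function of its height. -/
theorem eventually_isCentroidDist_iff (hX : IsStrictlyLocallyConvex X I N) (hI : IsOpen I)
    (hs : s ∈ I) (B : ChordBranches (height X s) α β s) :
    ∀ᶠ y in 𝓝[>] 0, ∀ k,
      IsCentroidDist X I N s (normalAcceleration X N s * y) k ↔
        k = normalAcceleration X N s * (2 / 3 * y + chordLength (abscissa X s) α β y /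
          deriv (chordLength (abscissa X s) α β) y / 3) := by
  have hX' := hX.isNondegenerateOn hI
  have hO := hX'.isOsculating hs
  filter_upwards [hX.eventually_isChord_iff (hI.mem_nhds hs) B, self_mem_nhdsWithin,
    B.left.eventually_right_inv, B.right.eventually_right_inv,
    hX'.eventually_heightPart_ne_zero hs B.left, hX'.eventually_heightPart_ne_zero hs B.right,
    hX'.eventually_deriv_chordLength hs B, hO.eventually_chordLength_pos B,
    hO.eventually_deriv_chordLength_pos B] with y hchord hy hα hβ hα' hβ' hrate hL hL' k
  have hne := hrate ▸ hL'.ne'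
  have hdist {Q A₁ B₁ : Plane} (hQα : Q ∈ tangentLine X (α y)) (hQβ : Q ∈ tangentLine X (β y))
      (hA : A₁ ∈ tangentLine X s) (hB : B₁ ∈ tangentLine X s) :
      Metric.infDist (Finset.univ.centroid ℝ ![Q, A₁, B₁])
          (chordLine X N s (normalAcceleration X N s * y)) =
        normalAcceleration X N s * (2 / 3 * y + chordLength (abscissa X s) α β y /
          deriv (chordLength (abscissa X s) α β) y / 3) := by
    have hQ := heightPart_tangentLine_inter hQα hQβ (hα.trans hβ.symm) hα' hβ' hne
    rw [← hrate, hα, ← chordLength] at hQ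
    rw [hX.infDist_centroid_chordLine hs (le_of_lt hy) hA hB
      (hQ.trans_le (sub_le_self y (div_pos hL hL').le)), hQ]
    ring
  constructor
  · rintro ⟨a, b, Q, A₁, B₁, hab, hQ, hA, hB, rfl⟩
    obtain ⟨rfl, rfl⟩ := (hchord a b).1 hab
    have hQ := hQ.ge (mem_singleton Q)
    exact hdist hQ.1 hQ.2 (hA.ge (mem_singleton A₁)).2 (hB.ge (mem_singleton B₁)).2
  · rintro rfl
    have hQ := inter_lineThrough_eq_singleton (p := X (α y)) (q := X (β y))
      (wedge_velocity_ne_zero (hX'.wedge_ne_zero s hs) hα' hβ' hne)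
    have hA := inter_lineThrough_eq_singleton (p := X (α y)) (q := X s)
      (wedge_velocity_self_ne_zero hα')
    have hB := inter_lineThrough_eq_singleton (p := X (β y)) (q := X s)
      (wedge_velocity_self_ne_zero hβ')
    refine ⟨α y, β y, _, _, _, (hchord _ _).2 ⟨rfl, rfl⟩, hQ, hA, hB, ?_⟩
    exact (hdist (hQ.ge (mem_singleton _)).1 (hQ.ge (mem_singleton _)).2
      (hA.ge (mem_singleton _)).2 (hB.ge (mem_singleton _)).2).symm

theorem eventually_isCentroidDist_four_thirds_iff (hX : IsStrictlyLocallyConvex X I N)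
    (hI : IsOpen I) (hs : s ∈ I) (B : ChordBranches (height X s) α β s) :
    (∀ᶠ h in 𝓝[>] 0, IsCentroidDist X I N s h (4 / 3 * h)) ↔
      ∀ᶠ y in 𝓝[>] 0, chordLength (abscissa X s) α β y ^ 2 = 8 * y := by
  have hO := (hX.isNondegenerateOn hI).isOsculating hs
  have hκ := hX.normalAcceleration_pos hs
  rw [← eventually_nhdsGT_zero_mul_left_iff hκ, hO.eventually_chordLength_sq_iff B]
  refine eventually_congr ?_
  filter_upwards [hX.eventually_isCentroidDist_iff hI hs B, hO.eventually_deriv_chordLength_pos B]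
    with y hdist hL'
  rw [hdist, mul_left_comm, mul_right_inj' hκ.ne', ← div_eq_iff hL'.ne']
  constructor <;> intro h <;> linarith

theorem eventually_isCentroidDist_four_thirds_of_rpow (hX : IsStrictlyLocallyConvex X I N)
    (hI : IsOpen I) (hs : s ∈ I) {c m : ℝ}
    (hpow : ∀ᶠ h in 𝓝[>] (0 : ℝ), IsCentroidDist X I N s h (c * h ^ m)) :
    ∀ᶠ h in 𝓝[>] 0, IsCentroidDist X I N s h (4 / 3 * h) := by
  have hX' := hX.isNondegenerateOn hI
  have hκ := hX.normalAcceleration_pos hs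
  obtain ⟨α, β, B⟩ := hX'.exists_chordBranches hs
  set κ := normalAcceleration X N s with hκ_def
  have hlim : Tendsto (fun y => c * κ ^ (m - 1) * y ^ (m - 1)) (𝓝[>] 0) (𝓝 (4 / 3)) := by
    have hratio := (((hX'.isOsculating hs).tendsto_chordLength_div_deriv_div B).div_const
      3).const_add (2 / 3)
    norm_num at hratio
    refine hratio.congr' ?_
    filter_upwards [hX.eventually_isCentroidDist_iff hI hs B,
      (eventually_nhdsGT_zero_mul_left_iff hκ).2 hpow, self_mem_nhdsWithin] with y hdist hy hy0
    rw [hdist, ← hκ_def] at hy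
    rw [mul_assoc, ← Real.mul_rpow hκ.le (le_of_lt hy0),
      Real.rpow_sub_one (mul_pos hκ hy0).ne', ← mul_div_assoc, hy]
    have : y ≠ 0 := ne_of_gt hy0
    field_simp
  obtain rfl : m = 1 := sub_eq_zero.1 (eq_zero_of_tendsto_mul_rpow (by norm_num) hlim)
  simp only [sub_self, Real.rpow_zero, mul_one] at hlim
  obtain rfl : c = 4 / 3 := tendsto_nhds_unique tendsto_const_nhds hlim
  simpa only [Real.rpow_one] using hpow

end IsStrictlyLocallyConvex

/-! ### The equation of a parabola in the frame -/

namespace IsOsculating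

variable {A Y : ℝ → ℝ} {s : ℝ}

theorem coeff_eq_of_eventually (h : IsOsculating A Y s) {l : Filter ℝ} [l.NeBot] (hl : l ≤ 𝓝[≠] s)
    {p q r e f : ℝ} (hzero : ∀ᶠ u in l, p + q * A u + r * Y u + (e * A u + f * Y u) ^ 2 = 0) :
    p = 0 ∧ q = 0 ∧ r = -2 * e ^ 2 := by
  have hs : l ≤ 𝓝 s := hl.trans nhdsWithin_le_nhds
  have hne : ∀ᶠ u in l, u - s ≠ 0 :=
    hl (eventually_mem_nhdsWithin.mono fun u hu => sub_ne_zero.2 hu)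
  have hA := h.tendsto_fst_nhds.mono_left hs
  have hY := h.tendsto_snd_nhds.mono_left hs
  have hA₁ := h.tendsto_fst_div.mono_left hl
  have hY₂ := h.tendsto_snd_div_sq.mono_left hl
  have hsub : Tendsto (fun u => u - s) l (𝓝 0) := by
    simpa only [id, sub_self] using (tendsto_id.mono_right hs).sub_const s
  have hY₁ : Tendsto (fun u => Y u / (u - s)) l (𝓝 0) := by
    have hmul := hY₂.mul hsub
    rw [mul_zero] at hmul
    refine hmul.congr' (hne.mono fun u hu => ?_)
    field_simp
  have hzero_tendsto : Tendsto (fun _ : ℝ => (0 : ℝ)) l (𝓝 0) := tendsto_const_nhds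
  have hlin := (hA.const_mul e).add (hY.const_mul f)
  have hlin₁ := (hA₁.const_mul e).add (hY₁.const_mul f)
  obtain rfl : p = 0 := by
    have hlim := (((hA.const_mul q).const_add p).add (hY.const_mul r)).add (hlin.pow 2)
    simpa using tendsto_nhds_unique (hlim.congr' hzero) hzero_tendsto
  obtain rfl : q = 0 := by
    have hlim := ((hA₁.const_mul q).add (hY₁.const_mul r)).add (hlin₁.mul hlin)
    have := tendsto_nhds_unique (hlim.congr' ?_) hzero_tendsto
    · simpa using this
    · filter_upwards [hzero, hne] with u hu hu'
      field_simp
      linear_combination hu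
  have hlim := (hY₂.const_mul r).add (hlin₁.pow 2)
  have := tendsto_nhds_unique (hlim.congr' ?_) hzero_tendsto
  · exact ⟨rfl, rfl, by linear_combination 2 * this⟩
  · filter_upwards [hzero, hne] with u hu hu'
    field_simp
    linear_combination hu

end IsOsculating

section NormalForm

variable {X : ℝ → Plane} {I : Set ℝ} {s : ℝ}

theorem inner_eq_frame (hD : wedge (deriv X s) (deriv (deriv X) s) ≠ 0) (c p : Plane) :
    inner ℝ c p = inner ℝ c (X s) + inner ℝ c (deriv X s) * tangentPart X s (p - X s) +
      inner ℝ c (deriv (deriv X) s) * heightPart X s (p - X s) := by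
  conv_lhs => rw [← add_sub_cancel (X s) p, frame_decomposition hD (p - X s)]
  simp only [inner_add_right, real_inner_smul_right]
  ring

theorem isParabola_of_normal_form (hD : wedge (deriv X s) (deriv (deriv X) s) ≠ 0) (ρ : ℝ) :
    IsParabola {p | (tangentPart X s (p - X s) + ρ * heightPart X s (p - X s)) ^ 2 =
      2 * heightPart X s (p - X s)} := by
  let c : Plane := (InnerProductSpace.toDual ℝ Plane).symm (tangentPart X s + ρ • heightPart X s)
  let d : Plane := (InnerProductSpace.toDual ℝ Plane).symm ((2 : ℝ) • heightPart X s)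
  have hc (v : Plane) : inner ℝ c v = tangentPart X s v + ρ * heightPart X s v :=
    InnerProductSpace.toDual_symm_apply
  have hd (v : Plane) : inner ℝ d v = 2 * heightPart X s v := InnerProductSpace.toDual_symm_apply
  have hcd : wedge c d ≠ 0 := by
    refine left_ne_zero_of_mul (b := wedge (deriv X s) (deriv (deriv X) s)) ?_
    rw [← inner_mul_inner_sub, hc, hc, hd, hd, tangentPart_velocity hD, heightPart_velocity,
      tangentPart_acceleration, heightPart_acceleration hD]
    norm_num
  refine (isParabola_iff _).2 ⟨c, d, -inner ℝ c (X s), -inner ℝ d (X s), hcd, ?_⟩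
  ext p
  rw [mem_ofPred_eq, mem_ofPred_eq, ← sub_eq_add_neg, ← sub_eq_add_neg, ← inner_sub_right,
    ← inner_sub_right, hc, hd]

/-- Substituting the frame expansion into the equation of the parabola, the contact of the curve
with its tangent line determines all coefficients but one. -/
theorem IsNondegenerateOn.exists_normal_form (hX : IsNondegenerateOn X I) (hs : s ∈ I)
    {S : Set Plane} (hS : IsParabola S) {l : Filter ℝ} [l.NeBot] (hl : l ≤ 𝓝[≠] s)
    (hmem : ∀ᶠ u in l, X u ∈ S) :
    ∃ ρ : ℝ, ∀ p, p ∈ S ↔ (tangentPart X s (p - X s) + ρ * heightPart X s (p - X s)) ^ 2 =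
      2 * heightPart X s (p - X s) := by
  obtain ⟨c, d, a, b, hcd, rfl⟩ := (isParabola_iff S).1 hS
  have hD := hX.wedge_ne_zero s hs
  set c₀ := inner ℝ c (X s) + a
  set c₁ := inner ℝ c (deriv X s) with hc₁_def
  set c₂ := inner ℝ c (deriv (deriv X) s) with hc₂_def
  set d₁ := inner ℝ d (deriv X s) with hd₁_def
  set d₂ := inner ℝ d (deriv (deriv X) s) with hd₂_def
  have hexpand (p : Plane) : (inner ℝ c p + a) ^ 2 = inner ℝ d p + b ↔
      c₀ ^ 2 - (inner ℝ d (X s) + b) + (2 * c₀ * c₁ - d₁) * tangentPart X s (p - X s) +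
        (2 * c₀ * c₂ - d₂) * heightPart X s (p - X s) +
          (c₁ * tangentPart X s (p - X s) + c₂ * heightPart X s (p - X s)) ^ 2 = 0 := by
    rw [inner_eq_frame hD c p, inner_eq_frame hD d p, ← sub_eq_zero]
    exact Eq.congr_left (by ring)
  obtain ⟨h₀, h₁, h₂⟩ := (hX.isOsculating hs).coeff_eq_of_eventually hl
    (hmem.mono fun u hu => (hexpand (X u)).1 hu)
  have hc₁ : c₁ ≠ 0 := by
    intro hc₁
    have hdet := mul_ne_zero hcd hD
    rw [← inner_mul_inner_sub, ← hc₁_def, ← hc₂_def, ← hd₁_def, ← hd₂_def] at hdet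
    exact hdet (by linear_combination c₂ * h₁ + (d₂ - 2 * c₀ * c₂) * hc₁)
  refine ⟨c₂ / c₁, fun p => ?_⟩
  rw [mem_ofPred_eq, hexpand, h₀, h₁, h₂]
  refine (Eq.congr_left ?_).trans ((mul_eq_zero_iff_left (pow_ne_zero 2 hc₁)).trans sub_eq_zero)
  field_simp
  ring

end NormalForm

/-! ### Chords at constant height above a moving tangent line -/

namespace IsOsculating

variable {A Y α β : ℝ → ℝ} {s q : ℝ}

theorem eventually_add_eq_of_rate_eq (h : IsOsculating A Y s) (B : ChordBranches Y α β s)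
    (hchord : ∀ᶠ y in 𝓝[>] 0, chordLength A α β y ^ 2 = 8 * y)
    (hrate : ∀ᶠ y in 𝓝[>] 0, (A (α y) + y * q) * (deriv A (α y) / deriv Y (α y)) =
      (A (β y) + y * q) * (deriv A (β y) / deriv Y (β y))) :
    ∀ᶠ y in 𝓝[>] 0, A (α y) + A (β y) + 2 * (q / 3 * y) = 0 := by
  let M : ℝ → ℝ := fun y =>
    (A (β y) ^ 2 - A (α y) ^ 2) / 2 + q / 3 * (y * chordLength A α β y)
  have hM : ∀ᶠ y in 𝓝[>] 0, HasDerivAt M 0 y := by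
    filter_upwards [hrate, h.eventually_hasDerivAt_comp B.left,
      h.eventually_hasDerivAt_comp B.right, h.eventually_hasDerivAt_chordLength B,
      (h.eventually_chordLength_sq_iff B).1 hchord] with y hrate hα hβ hL hode
    rw [hL.deriv] at hode
    refine ((((hβ.fun_pow 2).fun_sub (hα.fun_pow 2)).div_const 2).fun_add
      (((hasDerivAt_id' y).fun_mul hL).const_mul (q / 3))).congr_deriv ?_
    rw [hode]
    norm_num
    linear_combination -hrate
  have hM₀ : Tendsto M (𝓝[>] 0) (𝓝 0) := by
    have hα := h.tendsto_fst_nhds.comp B.left.tendsto_nhds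
    have hβ := h.tendsto_fst_nhds.comp B.right.tendsto_nhds
    have hy : Tendsto (fun y : ℝ => y) (𝓝[>] 0) (𝓝 0) := tendsto_id.mono_left nhdsWithin_le_nhds
    have hlim := (((hβ.pow 2).sub (hα.pow 2)).div_const 2).add
      ((hy.mul (hβ.sub hα)).const_mul (q / 3))
    simpa [M, chordLength, Function.comp_def] using hlim
  filter_upwards [eventually_eq_of_hasDerivAt_zero hM hM₀, h.eventually_chordLength_pos B]
    with y hMy hL
  refine (mul_eq_zero.1 ?_).resolve_left hL.ne'
  simp only [M, chordLength] at hMy ⊢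
  linear_combination 2 * hMy

theorem eventually_sq_eq_of_rate_eq (h : IsOsculating A Y s) (B : ChordBranches Y α β s)
    (hchord : ∀ᶠ y in 𝓝[>] 0, chordLength A α β y ^ 2 = 8 * y)
    (hrate : ∀ᶠ y in 𝓝[>] 0, (A (α y) + y * q) * (deriv A (α y) / deriv Y (α y)) =
      (A (β y) + y * q) * (deriv A (β y) / deriv Y (β y))) :
    ∀ᶠ u in 𝓝 s, (A u + q / 3 * Y u) ^ 2 = 2 * Y u := by
  refine h.eventually_sq_eq_nhds B hchord (.inl ((h.eventually_sq_eq_iff B.left _).2 ?_))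
  filter_upwards [h.eventually_add_eq_of_rate_eq B hchord hrate,
    (h.eventually_chordLength_sq_iff_eq_sqrt B).1 hchord] with y hsum hL
  rw [chordLength] at hL
  linear_combination (hsum - hL) / 2

end IsOsculating

theorem exists_implicit_curve {f : ℝ × ℝ → ℝ} {a b d : ℝ} (hf : ContDiffAt ℝ 1 f (a, b))
    (hd : HasDerivAt (fun v => f (a, v)) d b) (hd₀ : d ≠ 0) :
    ∃ ψ : ℝ → ℝ, ψ a = b ∧ DifferentiableAt ℝ ψ a ∧ ∀ᶠ t in 𝓝 a, f (t, ψ t) = f (a, b) := by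
  have hf' := hf.hasStrictFDerivAt one_ne_zero
  have hpartial : fderiv ℝ f (a, b) (0, 1) = d :=
    (hf'.hasFDerivAt.comp_hasDerivAt b
      ((hasDerivAt_const b a).prodMk (hasDerivAt_id' b))).unique hd
  have hinv : (fderiv ℝ f (a, b) ∘L .inr ℝ ℝ ℝ).IsInvertible := by
    refine .of_inverse (g := d⁻¹ • .id ℝ ℝ) ?_ ?_ <;> ext <;> simp [hpartial, hd₀]
  have hψ := (hf'.hasStrictFDerivAt_implicitFunctionOfProdDomain hinv).differentiableAt
  exact ⟨hf'.implicitFunctionOfProdDomain hinv,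
    tendsto_nhds_unique hψ.continuousAt.tendsto (hf'.tendsto_implicitFunctionOfProdDomain hinv),
    hψ, hf'.eventually_apply_implicitFunctionOfProdDomain hinv⟩

/-- `X (ψ t)` is the point of the curve that starts at `X u` for `t = s` and stays at constant
height above the tangent line at `X t`. -/
structure IsLevelCurve (X : ℝ → Plane) (ψ : ℝ → ℝ) (s u : ℝ) : Prop where
  apply_self : ψ s = u
  differentiableAt : DifferentiableAt ℝ ψ s
  eventually_height_eq : ∀ᶠ t in 𝓝 s, height X t (ψ t) = height X s u

namespace IsNondegenerateOn

variable {X : ℝ → Plane} {I : Set ℝ} {s u : ℝ}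

theorem contDiffAt_inv_wedge (hX : IsNondegenerateOn X I) (hs : s ∈ I) :
    ContDiffAt ℝ 1 (fun t => (wedge (deriv X t) (deriv (deriv X) t))⁻¹) s :=
  ((wedge.contDiff.contDiffAt.comp s ((hX.contDiffAt_deriv hs).of_le one_le_two)).clm_apply
    (hX.contDiffAt_deriv_deriv hs)).inv (hX.wedge_ne_zero s hs)

theorem contDiffAt_heightPart (hX : IsNondegenerateOn X I) (hs : s ∈ I) :
    ContDiffAt ℝ 1 (heightPart X) s :=
  (hX.contDiffAt_inv_wedge hs).smul
    (wedge.contDiff.contDiffAt.comp s ((hX.contDiffAt_deriv hs).of_le one_le_two))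

theorem contDiffAt_tangentPart (hX : IsNondegenerateOn X I) (hs : s ∈ I) :
    ContDiffAt ℝ 1 (tangentPart X) s :=
  (hX.contDiffAt_inv_wedge hs).smul
    (wedge.flip.contDiff.contDiffAt.comp s (hX.contDiffAt_deriv_deriv hs))

theorem contDiffAt_height (hX : IsNondegenerateOn X I) (hs : s ∈ I) (hu : u ∈ I) :
    ContDiffAt ℝ 1 (fun z : ℝ × ℝ => height X z.1 z.2) (s, u) :=
  ((hX.contDiffAt_heightPart hs).comp (s, u) contDiffAt_fst).clm_apply
    ((((hX.contDiffAt hu).of_le (by norm_num)).comp (s, u) contDiffAt_snd).sub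
      (((hX.contDiffAt hs).of_le (by norm_num)).comp (s, u) contDiffAt_fst))

theorem exists_isLevelCurve (hX : IsNondegenerateOn X I) (hs : s ∈ I) (hu : u ∈ I)
    (hne : heightPart X s (deriv X u) ≠ 0) : ∃ ψ, IsLevelCurve X ψ s u := by
  obtain ⟨ψ, hψs, hψ, hheight⟩ :=
    exists_implicit_curve (hX.contDiffAt_height hs hu) (hX.hasDerivAt_height s hu) hne
  exact ⟨ψ, hψs, hψ, hheight⟩

theorem differentiableAt_abscissa_comp (hX : IsNondegenerateOn X I) (hs : s ∈ I) {ψ : ℝ → ℝ}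
    (hu : ψ s ∈ I) (hψ : DifferentiableAt ℝ ψ s) :
    DifferentiableAt ℝ (fun t => abscissa X t (ψ t)) s :=
  ((hX.contDiffAt_tangentPart hs).differentiableAt one_ne_zero).clm_apply
    (((hX.hasDerivAt hu).differentiableAt.comp s hψ).sub (hX.hasDerivAt hs).differentiableAt)

/-- Differentiate `X (ψ t) = X t + a t • X' t + y • X'' t`, where the height `y` is constant. -/
theorem hasDerivAt_abscissa_comp (hX : IsNondegenerateOn X I) (hs : s ∈ I) (hu : u ∈ I)
    (hne : heightPart X s (deriv X u) ≠ 0) {ψ : ℝ → ℝ} (hψ : IsLevelCurve X ψ s u) :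
    HasDerivAt (fun t => abscissa X t (ψ t))
      ((abscissa X s u + height X s u * heightPart X s (deriv (deriv (deriv X)) s)) *
        (tangentPart X s (deriv X u) / heightPart X s (deriv X u)) - 1 -
          height X s u * tangentPart X s (deriv (deriv (deriv X)) s)) s := by
  obtain ⟨rfl, hψ', hheight⟩ := hψ
  have hD := hX.wedge_ne_zero s hs
  have ha := (hX.differentiableAt_abscissa_comp hs hu hψ').hasDerivAt
  refine ha.congr_deriv ?_
  have hexpand : (fun t => X (ψ t)) =ᶠ[𝓝 s] (X + (fun t => abscissa X t (ψ t)) • deriv X) +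
      height X s (ψ s) • deriv (deriv X) := by
    filter_upwards [hheight, hX.mem_nhds hs] with t ht htI
    have hframe := frame_decomposition (hX.wedge_ne_zero t htI) (X (ψ t) - X t)
    rw [← abscissa, ← height, ht, sub_eq_iff_eq_add'] at hframe
    rw [hframe, ← add_assoc]
    rfl
  have hvel := ((hX.hasDerivAt hu).scomp s hψ'.hasDerivAt).unique
    ((((hX.hasDerivAt hs).add (ha.smul (hX.hasDerivAt_deriv hs))).add
      ((hX.hasDerivAt_deriv_deriv hs).const_smul (height X s (ψ s)))).congr_of_eventuallyEq
        hexpand)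
  have hT := congrArg (tangentPart X s) hvel
  have hH := congrArg (heightPart X s) hvel
  simp only [map_add, map_smul, smul_eq_mul, tangentPart_velocity hD, tangentPart_acceleration,
    heightPart_velocity, heightPart_acceleration hD] at hT hH
  field_simp
  linear_combination -heightPart X s (deriv X (ψ s)) * hT + tangentPart X s (deriv X (ψ s)) * hH

end IsNondegenerateOn

/-- All chords parallel to the tangent line at `s` whose end points have parameters within `δ` of
`s`, one on each side, have the length of the chords of a parabola. -/
def HasParabolicChords (X : ℝ → Plane) (s δ : ℝ) : Prop :=
  ∀ u ∈ Ioo (s - δ) s, ∀ v ∈ Ioo s (s + δ), height X s u = height X s v →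
    (abscissa X s v - abscissa X s u) ^ 2 = 8 * height X s u

theorem HasParabolicChords.mono {X : ℝ → Plane} {s δ ε : ℝ} (h : HasParabolicChords X s ε)
    (hδ : δ ≤ ε) : HasParabolicChords X s δ := fun u hu v hv =>
  h u (Ioo_subset_Ioo_left (by linarith) hu) v (Ioo_subset_Ioo_right (by linarith) hv)

theorem IsLevelCurve.eventually_chord_sq_eq {X : ℝ → Plane} {φ ψ : ℝ → ℝ} {s u v δ : ℝ}
    (hψ : IsLevelCurve X ψ s u) (hφ : IsLevelCurve X φ s v) (hu : u ∈ Ioo (s - δ) s)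
    (hv : v ∈ Ioo s (s + δ)) (huv : height X s u = height X s v) :
    ∀ᶠ t in 𝓝 s, HasParabolicChords X t δ →
      (abscissa X t (φ t) - abscissa X t (ψ t)) ^ 2 = 8 * height X s u := by
  have hψ' := hψ.differentiableAt.continuousAt
  have hφ' := hφ.differentiableAt.continuousAt
  filter_upwards [hψ.eventually_height_eq, hφ.eventually_height_eq,
    (continuousAt_id.sub_const δ).eventually_lt hψ' (hψ.apply_self.symm ▸ hu.1),
    hψ'.eventually_lt continuousAt_id (hψ.apply_self.symm ▸ hu.2),
    continuousAt_id.eventually_lt hφ' (hφ.apply_self.symm ▸ hv.1),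
    hφ'.eventually_lt (continuousAt_id.add_const δ) (hφ.apply_self.symm ▸ hv.2)]
    with t htψ htφ hψ₁ hψ₂ hφ₁ hφ₂ hpar
  rw [hpar (ψ t) ⟨hψ₁, hψ₂⟩ (φ t) ⟨hφ₁, hφ₂⟩ (htψ.trans (huv.trans htφ.symm)), htψ]

namespace IsNondegenerateOn

variable {X : ℝ → Plane} {I : Set ℝ} {s u v δ : ℝ}

theorem rate_eq_of_hasParabolicChords (hX : IsNondegenerateOn X I) (hs : s ∈ I) (huI : u ∈ I)
    (hvI : v ∈ I) (hu : u ∈ Ioo (s - δ) s) (hv : v ∈ Ioo s (s + δ))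
    (huv : height X s u = height X s v) (hu₀ : heightPart X s (deriv X u) ≠ 0)
    (hv₀ : heightPart X s (deriv X v) ≠ 0) (hne : abscissa X s v - abscissa X s u ≠ 0)
    (hpar : ∀ᶠ t in 𝓝 s, HasParabolicChords X t δ) :
    (abscissa X s u + height X s u * heightPart X s (deriv (deriv (deriv X)) s)) *
        (tangentPart X s (deriv X u) / heightPart X s (deriv X u)) =
      (abscissa X s v + height X s u * heightPart X s (deriv (deriv (deriv X)) s)) *
        (tangentPart X s (deriv X v) / heightPart X s (deriv X v)) := by
  obtain ⟨ψ, hψ⟩ := hX.exists_isLevelCurve hs huI hu₀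
  obtain ⟨φ, hφ⟩ := hX.exists_isLevelCurve hs hvI hv₀
  have hconst : (fun t => (abscissa X t (φ t) - abscissa X t (ψ t)) ^ 2) =ᶠ[𝓝 s]
      fun _ => 8 * height X s u := by
    filter_upwards [hψ.eventually_chord_sq_eq hφ hu hv huv, hpar] with t ht hpar using ht hpar
  have hderiv := (((hX.hasDerivAt_abscissa_comp hs hvI hv₀ hφ).fun_sub
    (hX.hasDerivAt_abscissa_comp hs huI hu₀ hψ)).fun_pow 2).unique
      ((hasDerivAt_const s _).congr_of_eventuallyEq hconst)
  rw [hψ.apply_self, hφ.apply_self, ← huv, mul_eq_zero] at hderiv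
  linear_combination -hderiv.resolve_left (by simpa using hne)

theorem exists_eventually_sq_eq (hX : IsNondegenerateOn X I) (hs : s ∈ I) (hδ : 0 < δ)
    (hpar : ∀ᶠ t in 𝓝 s, HasParabolicChords X t δ) :
    ∃ ρ : ℝ, ∀ᶠ u in 𝓝 s, (abscissa X s u + ρ * height X s u) ^ 2 = 2 * height X s u := by
  have hO := hX.isOsculating hs
  obtain ⟨α, β, B⟩ := hX.exists_chordBranches hs
  have hα : ∀ᶠ y in 𝓝[>] 0, α y ∈ Ioo (s - δ) s :=
    B.left.tendsto (Ioo_mem_nhdsLT (sub_lt_self s hδ))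
  have hβ : ∀ᶠ y in 𝓝[>] 0, β y ∈ Ioo s (s + δ) :=
    B.right.tendsto (Ioo_mem_nhdsGT (lt_add_of_pos_right s hδ))
  refine ⟨_, hO.eventually_sq_eq_of_rate_eq (q := heightPart X s (deriv (deriv (deriv X)) s)) B
    ?_ ?_⟩
  · filter_upwards [hα, hβ, B.left.eventually_right_inv, B.right.eventually_right_inv]
      with y hα hβ hαy hβy
    have hchord := hpar.self_of_nhds _ hα _ hβ (hαy.trans hβy.symm)
    rwa [hαy] at hchord
  · filter_upwards [hα, hβ, B.left.eventually_right_inv, B.right.eventually_right_inv,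
      B.left.tendsto_nhds (hX.mem_nhds hs), B.right.tendsto_nhds (hX.mem_nhds hs),
      hX.eventually_heightPart_ne_zero hs B.left, hX.eventually_heightPart_ne_zero hs B.right,
      hO.eventually_chordLength_pos B] with y hα hβ hαy hβy hαI hβI hα₀ hβ₀ hL
    have hrate := hX.rate_eq_of_hasParabolicChords hs hαI hβI hα hβ (hαy.trans hβy.symm) hα₀ hβ₀
      hL.ne' hpar
    rwa [hαy, ← hX.deriv_abscissa s hαI, ← hX.deriv_abscissa s hβI, ← hX.deriv_height s hαI,
      ← hX.deriv_height s hβI] at hrate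

end IsNondegenerateOn

/-! ### From local to global -/

theorem exists_eventually_of_forall_exists {E : Type*} [TopologicalSpace E] [BaireSpace E]
    {J : Set E} (hJ : IsOpen J) (hne : J.Nonempty) {p : E → ℝ → Prop} {ε : ℝ} (hε : 0 < ε)
    (hmono : ∀ t δ₁ δ₂, δ₁ ≤ δ₂ → p t δ₂ → p t δ₁)
    (hopen : ∀ δ ≤ ε, ∀ t ∈ J, ¬ p t δ → ∀ᶠ t' in 𝓝 t, ¬ p t' δ)
    (hp : ∀ t ∈ J, ∃ δ > 0, p t δ) : ∃ t ∈ J, ∃ δ > 0, ∀ᶠ t' in 𝓝 t, p t' δ := by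
  obtain ⟨d, -, hd, hlim⟩ := exists_seq_strictAnti_tendsto' hε
  have := hJ.baireSpace
  have := hne.to_subtype
  have hclosed : ∀ n, IsClosed {t : J | p t (d n)} := fun n => by
    rw [← isOpen_compl_iff, isOpen_iff_mem_nhds]
    exact fun t ht => continuous_subtype_val.continuousAt.tendsto.eventually
      (hopen (d n) (hd n).2.le t t.2 ht)
  have hcover : ⋃ n, {t : J | p t (d n)} = univ := by
    refine eq_univ_of_forall fun t => ?_
    obtain ⟨δ, hδ, hpδ⟩ := hp t t.2
    obtain ⟨n, hn⟩ := (hlim.eventually_lt_const hδ).exists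
    exact mem_iUnion.2 ⟨n, hmono t _ _ hn.le hpδ⟩
  obtain ⟨n, t, ht⟩ := nonempty_interior_of_iUnion_of_closed hclosed hcover
  refine ⟨t, t.2, d n, (hd n).1, ?_⟩
  rwa [mem_interior_iff_mem_nhds, ← preimage_ofPred_eq (f := Subtype.val) (p := (p · (d n))),
    preimage_coe_mem_nhds_subtype, hJ.nhdsWithin_eq t.2] at ht

theorem eventually_nhds_of_le {α : Type*} [ConditionallyCompleteLinearOrder α]
    [TopologicalSpace α] [OrderTopology α] {p : α → Prop} {s t : α} (hst : s ≤ t)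
    (hs : ∀ᶠ u in 𝓝 s, p u)
    (hext : ∀ c ∈ Icc s t, (∀ᶠ u in 𝓝[<] c, p u) → ∀ᶠ u in 𝓝 c, p u) : ∀ᶠ u in 𝓝 t, p u := by
  have hopen : IsOpen {c | ∀ᶠ u in 𝓝 c, p u} :=
    isOpen_iff_mem_nhds.2 fun c hc => eventually_eventually_nhds.2 hc
  by_contra ht
  obtain ⟨c, ⟨hc, hcp⟩, hleast⟩ := (isCompact_Icc.diff hopen).exists_isLeast
    (⟨t, right_mem_Icc.2 hst, ht⟩ : (Icc s t \ {c | ∀ᶠ u in 𝓝 c, p u}).Nonempty)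
  have hsc : s < c := hc.1.lt_of_ne (by rintro rfl; exact hcp hs)
  refine hcp (hext c hc ?_)
  filter_upwards [Ioo_mem_nhdsLT hsc] with u hu
  by_contra hup
  exact hu.2.not_ge (hleast ⟨⟨hu.1.le, hu.2.le.trans hc.2⟩, fun h => hup h.self_of_nhds⟩)

theorem forall_of_eventually_of_forall_extend {I : Set ℝ} (hI : I.OrdConnected) {p : ℝ → Prop}
    {s : ℝ} (hs : s ∈ I) (hps : ∀ᶠ u in 𝓝 s, p u)
    (hext : ∀ t ∈ I, ((∀ᶠ u in 𝓝[<] t, p u) ∨ ∀ᶠ u in 𝓝[>] t, p u) → ∀ᶠ u in 𝓝 t, p u) :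
    ∀ t ∈ I, p t := fun t ht => by
  rcases le_total s t with hst | hts
  · exact (eventually_nhds_of_le hst hps fun c hc h =>
      hext c (hI.out hs ht hc) (.inl h)).self_of_nhds
  · exact (eventually_nhds_of_le (α := ℝᵒᵈ) hts hps fun c hc h =>
      hext c (hI.out ht hs ⟨hc.2, hc.1⟩) (.inr h)).self_of_nhds

theorem isOpen_image_of_deriv_ne_zero {f : ℝ → ℝ} {I : Set ℝ} (hI : IsOpen I)
    (hf : ContDiffOn ℝ 1 f I) (hne : ∀ s ∈ I, deriv f s ≠ 0) : IsOpen (f '' I) := by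
  rw [isOpen_iff_mem_nhds]
  rintro _ ⟨s, hs, rfl⟩
  have hfs := (hf.contDiffAt (hI.mem_nhds hs)).hasStrictDerivAt one_ne_zero
  rw [← hfs.map_nhds_eq (hne s hs)]
  exact image_mem_map (hI.mem_nhds hs)

namespace IsNondegenerateOn

variable {X : ℝ → Plane} {I : Set ℝ} {s t u δ : ℝ} {α β : ℝ → ℝ}

theorem eventually_heightPart_deriv_deriv_pos (hX : IsNondegenerateOn X I) (hs : s ∈ I) :
    ∀ᶠ z : ℝ × ℝ in 𝓝 (s, s), 0 < heightPart X z.1 (deriv (deriv X) z.2) := by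
  have hcont : ContDiffAt ℝ 1 (fun z : ℝ × ℝ => heightPart X z.1 (deriv (deriv X) z.2)) (s, s) :=
    ((hX.contDiffAt_heightPart hs).comp (s, s) contDiffAt_fst).clm_apply
      ((hX.contDiffAt_deriv_deriv hs).comp (s, s) contDiffAt_snd)
  refine hcont.continuousAt.tendsto.eventually_const_lt ?_
  rw [heightPart_acceleration (hX.wedge_ne_zero s hs)]
  exact one_pos

theorem heightPart_deriv_ne_zero (hX : IsNondegenerateOn X I) {J : Set ℝ} (hJ : Convex ℝ J)
    (hJI : J ⊆ I) (hpos : ∀ v ∈ J, 0 < heightPart X t (deriv (deriv X) v)) (ht : t ∈ J)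
    (hu : u ∈ J) (hut : u ≠ t) : heightPart X t (deriv X u) ≠ 0 := by
  have hderiv : ∀ v ∈ J, HasDerivAt (fun v => heightPart X t (deriv X v))
      (heightPart X t (deriv (deriv X) v)) v := fun v hv =>
    (heightPart X t).hasFDerivAt.comp_hasDerivAt v (hX.hasDerivAt_deriv (hJI hv))
  have hmono : StrictMonoOn (fun v => heightPart X t (deriv X v)) J :=
    strictMonoOn_of_deriv_pos hJ (fun v hv => (hderiv v hv).continuousAt.continuousWithinAt)
      fun v hv => by rw [(hderiv v (interior_subset hv)).deriv]; exact hpos v (interior_subset hv)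
  intro h
  exact hut (hmono.injOn hu ht (h.trans (heightPart_velocity X t).symm))

theorem exists_heightPart_deriv_ne_zero (hX : IsNondegenerateOn X I) (hs : s ∈ I) :
    ∃ ε > 0, Ioo (s - ε) (s + ε) ⊆ I ∧ ∀ t ∈ Ioo (s - ε) (s + ε), ∀ u ∈ Ioo (s - ε) (s + ε),
      u ≠ t → heightPart X t (deriv X u) ≠ 0 := by
  have hpos := hX.eventually_heightPart_deriv_deriv_pos hs
  rw [nhds_prod_eq] at hpos
  obtain ⟨V, hV, hpos⟩ := eventually_prod_self_iff'.1 hpos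
  obtain ⟨ε, hε, hball⟩ := Metric.mem_nhds_iff.1 (inter_mem hV (hX.mem_nhds hs))
  rw [Real.ball_eq_Ioo, subset_inter_iff] at hball
  exact ⟨ε, hε, hball.2, fun t ht u hu => hX.heightPart_deriv_ne_zero (convex_Ioo _ _) hball.2
    (fun v hv => hpos t (hball.1 ht) v (hball.1 hv)) ht hu⟩

theorem exists_hasParabolicChords (B : ChordBranches (height X s) α β s)
    (hchord : ∀ᶠ y in 𝓝[>] 0, chordLength (abscissa X s) α β y ^ 2 = 8 * y) :
    ∃ δ > 0, HasParabolicChords X s δ := by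
  obtain ⟨a, ha, hleft⟩ := mem_nhdsLT_iff_exists_Ioo_subset.1
    (B.left.eventually_left_inv.and (B.left.eventually_iff.1 hchord))
  obtain ⟨b, hb, hright⟩ := mem_nhdsGT_iff_exists_Ioo_subset.1 B.right.eventually_left_inv
  refine ⟨min (s - a) (b - s), lt_min (sub_pos.2 ha) (sub_pos.2 hb), fun u hu v hv huv => ?_⟩
  obtain ⟨hαu, hL⟩ :=
    hleft (⟨by linarith [hu.1, min_le_left (s - a) (b - s)], hu.2⟩ : u ∈ Ioo a s)
  have hβv : β (height X s v) = v := hright ⟨hv.1, by linarith [hv.2, min_le_right (s - a) (b - s)]⟩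
  rw [← huv] at hβv
  rwa [chordLength, hαu, hβv] at hL

theorem eventually_not_hasParabolicChords (hX : IsNondegenerateOn X I)
    (hI : Ioo (s - δ) (s + δ) ⊆ I)
    (hne : ∀ u ∈ Ioo (s - δ) (s + δ), u ≠ s → heightPart X s (deriv X u) ≠ 0)
    (h : ¬ HasParabolicChords X s δ) : ∀ᶠ t in 𝓝 s, ¬ HasParabolicChords X t δ := by
  simp only [HasParabolicChords, not_forall] at h
  obtain ⟨u, hu, v, hv, huv, hlen⟩ := h
  have huI : u ∈ Ioo (s - δ) (s + δ) := ⟨hu.1, hu.2.trans (hv.1.trans hv.2)⟩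
  have hvI : v ∈ Ioo (s - δ) (s + δ) := ⟨hu.1.trans (hu.2.trans hv.1), hv.2⟩
  have hs : s ∈ I := hI ⟨hu.1.trans hu.2, hv.1.trans hv.2⟩
  obtain ⟨ψ, hψ⟩ := hX.exists_isLevelCurve hs (hI huI) (hne u huI hu.2.ne)
  obtain ⟨φ, hφ⟩ := hX.exists_isLevelCurve hs (hI hvI) (hne v hvI hv.1.ne')
  have hcont : ContinuousAt (fun t => (abscissa X t (φ t) - abscissa X t (ψ t)) ^ 2) s :=
    (((hX.differentiableAt_abscissa_comp hs (hφ.apply_self ▸ hI hvI) hφ.differentiableAt).sub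
      (hX.differentiableAt_abscissa_comp hs (hψ.apply_self ▸ hI huI)
        hψ.differentiableAt)).pow 2).continuousAt
  have hlen' := hcont.eventually_ne (by rwa [hψ.apply_self, hφ.apply_self])
  filter_upwards [hψ.eventually_chord_sq_eq hφ hu hv huv, hlen'] with t ht hlen' hpar
    using hlen' (ht hpar)

theorem exists_eventually_hasParabolicChords (hX : IsNondegenerateOn X I) (hI : I.Nonempty)
    (hpar : ∀ s ∈ I, ∃ δ > 0, HasParabolicChords X s δ) :
    ∃ s ∈ I, ∃ δ > 0, ∀ᶠ t in 𝓝 s, HasParabolicChords X t δ := by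
  obtain ⟨s, hs⟩ := hI
  obtain ⟨ε, hε, hsub, hne⟩ := hX.exists_heightPart_deriv_ne_zero hs
  have hball : ∀ δ ≤ ε / 2, ∀ t ∈ Ioo (s - ε / 2) (s + ε / 2),
      Ioo (t - δ) (t + δ) ⊆ Ioo (s - ε) (s + ε) := fun δ hδ t ht =>
    Ioo_subset_Ioo (by linarith [ht.1]) (by linarith [ht.2])
  have hmid : Ioo (s - ε / 2) (s + ε / 2) ⊆ Ioo (s - ε) (s + ε) :=
    Ioo_subset_Ioo (by linarith) (by linarith)
  obtain ⟨t, ht, δ, hδ, hev⟩ := exists_eventually_of_forall_exists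
    (p := HasParabolicChords X) isOpen_Ioo
    (⟨s, by linarith, by linarith⟩ : (Ioo (s - ε / 2) (s + ε / 2)).Nonempty) (half_pos hε)
    (fun t δ₁ δ₂ h hp => hp.mono h)
    (fun δ hδ t ht => hX.eventually_not_hasParabolicChords ((hball δ hδ t ht).trans hsub)
      fun u hu => hne t (hmid ht) u (hball δ hδ t ht hu))
    (fun t ht => hpar t (hsub (hmid ht)))
  exact ⟨t, hsub (hmid ht), δ, hδ, hev⟩

theorem hasDerivAt_inner (hX : IsNondegenerateOn X I) (c : Plane) (hs : s ∈ I) :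
    HasDerivAt (fun u => inner ℝ c (X u)) (inner ℝ c (deriv X s)) s :=
  (innerSL ℝ c).hasFDerivAt.comp_hasDerivAt s (hX.hasDerivAt hs)

theorem inner_deriv_ne_zero (hX : IsNondegenerateOn X I) {c d : Plane} (h : wedge c d ≠ 0)
    {a b : ℝ} (hsub : ∀ u ∈ I, (inner ℝ c (X u) + a) ^ 2 = inner ℝ d (X u) + b) (hs : s ∈ I) :
    inner ℝ c (deriv X s) ≠ 0 := by
  intro hc
  have heq : (fun u => (inner ℝ c (X u) + a) ^ 2) =ᶠ[𝓝 s] fun u => inner ℝ d (X u) + b := by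
    filter_upwards [hX.mem_nhds hs] using hsub
  have hd := (((hX.hasDerivAt_inner c hs).add_const a).fun_pow 2).unique
    (((hX.hasDerivAt_inner d hs).add_const b).congr_of_eventuallyEq heq)
  rw [hc, mul_zero] at hd
  exact left_ne_zero_of_wedge_ne_zero (hX.wedge_ne_zero s hs)
    (eq_zero_of_inner_eq_zero h hc hd.symm)

theorem isOpenPartOfParabola (hX : IsNondegenerateOn X I) {S : Set Plane} (hS : IsParabola S)
    (hsub : ∀ s ∈ I, X s ∈ S) : IsOpenPartOfParabola X I := by
  obtain ⟨c, d, a, b, hcd, rfl⟩ := (isParabola_iff S).1 hS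
  have hcX : ContDiffOn ℝ 1 (fun u => inner ℝ c (X u)) I :=
    contDiffOn_const.inner ℝ (hX.contDiffOn.of_le (by norm_num))
  have hopen : IsOpen ((fun u => inner ℝ c (X u)) '' I) := by
    refine isOpen_image_of_deriv_ne_zero hX.isOpen hcX fun s hs => ?_
    rw [(hX.hasDerivAt_inner c hs).deriv]
    exact hX.inner_deriv_ne_zero hcd hsub hs
  refine ⟨_, (inner ℝ c) ⁻¹' _, hS, hopen.preimage (innerSL ℝ c).continuous, ?_⟩
  ext p
  constructor
  · rintro ⟨s, hs, rfl⟩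
    exact ⟨hsub s hs, s, hs, rfl⟩
  · rintro ⟨hp, s, hs, hsp⟩
    have hXs := hsub s hs
    rw [mem_ofPred_eq] at hp hXs
    refine ⟨s, hs, sub_eq_zero.1 (eq_zero_of_inner_eq_zero hcd ?_ ?_)⟩
    · rw [inner_sub_right, sub_eq_zero]
      exact hsp
    · simp only at hsp
      rw [hsp, hp] at hXs
      rw [inner_sub_right]
      linear_combination -hXs

end IsNondegenerateOn

namespace IsStrictlyLocallyConvex

variable {X N : ℝ → Plane} {I : Set ℝ} {s : ℝ}

theorem exists_hasParabolicChords (hX : IsStrictlyLocallyConvex X I N) (hI : IsOpen I)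
    (hs : s ∈ I) (hcentroid : ∀ᶠ h in 𝓝[>] 0, IsCentroidDist X I N s h (4 / 3 * h)) :
    ∃ δ > 0, HasParabolicChords X s δ := by
  obtain ⟨α, β, B⟩ := (hX.isNondegenerateOn hI).exists_chordBranches hs
  exact IsNondegenerateOn.exists_hasParabolicChords B
    ((hX.eventually_isCentroidDist_four_thirds_iff hI hs B).1 hcentroid)

/-- The side on which the curve already runs along the parabola determines its normal form, and the
chord lengths then force the other side. -/
theorem eventually_mem_nhds_of_isParabola (hX : IsStrictlyLocallyConvex X I N) (hI : IsOpen I)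
    (hs : s ∈ I) (hcentroid : ∀ᶠ h in 𝓝[>] 0, IsCentroidDist X I N s h (4 / 3 * h))
    {S : Set Plane} (hS : IsParabola S)
    (hside : (∀ᶠ u in 𝓝[<] s, X u ∈ S) ∨ ∀ᶠ u in 𝓝[>] s, X u ∈ S) : ∀ᶠ u in 𝓝 s, X u ∈ S := by
  have hX' := hX.isNondegenerateOn hI
  obtain ⟨α, β, B⟩ := hX'.exists_chordBranches hs
  have hchord := (hX.eventually_isCentroidDist_four_thirds_iff hI hs B).1 hcentroid
  obtain ⟨ρ, hρ⟩ : ∃ ρ : ℝ, ∀ p, p ∈ S ↔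
      (tangentPart X s (p - X s) + ρ * heightPart X s (p - X s)) ^ 2 =
        2 * heightPart X s (p - X s) := by
    rcases hside with hside | hside
    · exact hX'.exists_normal_form hs hS (nhdsLT_le_nhdsNE s) hside
    · exact hX'.exists_normal_form hs hS (nhdsGT_le_nhdsNE s) hside
  simp only [hρ] at hside ⊢
  exact (hX'.isOsculating hs).eventually_sq_eq_nhds B hchord hside

theorem isOpenPartOfParabola_of_isCentroidDist (hX : IsStrictlyLocallyConvex X I N)
    (hI : IsOpen I) (hI' : I.OrdConnected) (hne : I.Nonempty)
    (hcentroid : ∀ s ∈ I, ∀ᶠ h in 𝓝[>] 0, IsCentroidDist X I N s h (4 / 3 * h)) :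
    IsOpenPartOfParabola X I := by
  have hX' := hX.isNondegenerateOn hI
  obtain ⟨s, hs, δ, hδ, hpar⟩ := hX'.exists_eventually_hasParabolicChords hne fun s hs =>
    hX.exists_hasParabolicChords hI hs (hcentroid s hs)
  obtain ⟨ρ, hρ⟩ := hX'.exists_eventually_sq_eq hs hδ hpar
  have hS := isParabola_of_normal_form (hX'.wedge_ne_zero s hs) ρ
  exact hX'.isOpenPartOfParabola hS (forall_of_eventually_of_forall_extend hI' hs hρ fun t ht =>
    hX.eventually_mem_nhds_of_isParabola hI ht (hcentroid t ht) hS)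

theorem eventually_isCentroidDist_of_isOpenPartOfParabola (hX : IsStrictlyLocallyConvex X I N)
    (hI : IsOpen I) (hP : IsOpenPartOfParabola X I) (hs : s ∈ I) :
    ∀ᶠ h in 𝓝[>] 0, IsCentroidDist X I N s h (4 / 3 * h) := by
  have hX' := hX.isNondegenerateOn hI
  obtain ⟨S, U, hS, -, hSU⟩ := hP
  have hmem : ∀ᶠ u in 𝓝 s, X u ∈ S := by
    filter_upwards [hX'.mem_nhds hs] with u hu using (hSU.le (mem_image_of_mem X hu)).1
  obtain ⟨ρ, hρ⟩ := hX'.exists_normal_form hs hS le_rfl (hmem.filter_mono nhdsWithin_le_nhds)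
  obtain ⟨α, β, B⟩ := hX'.exists_chordBranches hs
  rw [hX.eventually_isCentroidDist_four_thirds_iff hI hs B]
  exact (hX'.isOsculating hs).eventually_chordLength_sq B (hmem.mono fun u hu => (hρ _).1 hu)

end IsStrictlyLocallyConvex

end CentroidParabola

end

theorem theorem6 (X : ℝ → CentroidParabola.Plane) (I : Set ℝ) (N : ℝ → CentroidParabola.Plane)
    (hI_open : IsOpen I) (hI_interval : I.OrdConnected) (hI_nonempty : I.Nonempty)
    (hX : CentroidParabola.IsStrictlyLocallyConvex X I N) :
    List.TFAE [
      ∃ lam mu : ℝ → ℝ, ∀ s ∈ I, ∀ᶠ h in 𝓝[>] (0 : ℝ),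
        CentroidParabola.IsCentroidDist X I N s h (lam s * h ^ mu s),
      ∀ s ∈ I, ∀ᶠ h in 𝓝[>] (0 : ℝ),
        CentroidParabola.IsCentroidDist X I N s h (4 / 3 * h),
      CentroidParabola.IsOpenPartOfParabola X I] := by
  tfae_have 1 → 2 := by
    rintro ⟨lam, mu, h⟩ s hs
    exact hX.eventually_isCentroidDist_four_thirds_of_rpow hI_open hs (h s hs)
  tfae_have 2 → 1 := fun h => ⟨fun _ => 4 / 3, fun _ => 1, by simpa using h⟩
  tfae_have 2 → 3 :=
    hX.isOpenPartOfParabola_of_isCentroidDist hI_open hI_interval hI_nonempty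
  tfae_have 3 → 2 := fun h s hs =>
    hX.eventually_isCentroidDist_of_isOpenPartOfParabola hI_open h hs
  tfae_finish
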